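/- Let $\mathbb{L}_{\ge 0}=\omega_1\times[0,1)$ be the closed long ray (lexicographic order, order topology), identify $\alpha\in\omega_1$ with $\langle\alpha,0\rangle$, and let $O=\{\langle x,y\rangle\in\mathbb{L}_{\ge 0}^2: 0<y<x\}$ be the long-ray octant without its boundary. For every countable limit ordinal $\alpha$ (that is, $\alpha\in\omega_1$ is neither $0$ nor a successor) there is an order isomorphism $\Phi_\alpha$ from the interval $(0,\alpha+1)$ of $\mathbb{L}_{\ge 0}$ onto the real interval $(0,2)$ with $\Phi_\alpha(\alpha)=1$. Given any choice of such a family $\Phi=(\Phi_\alpha)$, let $S$ be obtained from the octant by Prüferising it at the points $\langle\alpha,\alpha\rangle$ of the diagonal, $\alpha$ a countable limit ordinal, and deleting the rest of its boundary. That is, $S$ is the disjoint union of $O$ and of copies $\mathbb{R}_\alpha$ of $\mathbb{R}$, one for each countable limit ordinal $\alpha$; $O$ with its usual topology is an open subspace of $S$, and a neighbourhood base in $S$ of the point $r\in\mathbb{R}_\alpha$ is given by the sets $$\{q\in\mathbb{R}_\alpha: u<q<v\}\ \cup\ \bigl\{\langle x,y\rangle\in O:\ x,y<\alpha+1,\ u\,(x'-y')<x'-1<v\,(x'-y'),\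 x'-y'<w\bigr\},$$ where $x'=\Phi_\alpha(x)$, $y'=\Phi_\alpha(y)$, $u<r<v$ and $w>0$ (so the vertical line below $\langle\alpha,\alpha\rangle$ converges to the point $0_\alpha:=0\in\mathbb{R}_\alpha$). Then $S$ is a surface, i.e. a Hausdorff space in which every point has a neighbourhood homeomorphic to $\mathbb{R}\times\mathbb{R}_{\ge 0}$. Its boundary $\partial S$ (the set of points without a neighbourhood homeomorphic to $\mathbb{R}^2$) is $\bigcup_\alpha\mathbb{R}_\alpha$; it is metrisable, and it is not collared in $S$, i.e. there is no embedding $h:\partial S\times[0,1]\to S$ with $h(x,0)=x$ for all $x\in\partial S$, $h^{-1}(\partial S)=\partial S\times\{0\}$ and $h(\partial S\times[0,1))$ open in $S$. The subset $D=\{0_\alpha:\alpha\text{ a countable limit ordinal}\}$ of $\partial S$ is closed and discrete in $S$, but it is not a $G_\delta$ subset of $S$, and hence it is not a zero-set of $S$ (it is not $f^{-1}(\{0\})$ for any continuous $f:S\to\mathbb{R}$). -/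

import Mathlib

open Set Topology Order

noncomputable section

/-! ### Manifolds with boundary in dimension two, and collars -/

/-- A (not necessarily connected, not necessarily metrisable) surface with boundary: a Hausdorff
space in which every point has a neighbourhood homeomorphic to the closed half plane. -/
def IsSurface (X : Type*) [TopologicalSpace X] : Prop :=
  T2Space X ∧ ∀ x : X, ∃ U ∈ 𝓝 x, Nonempty (U ≃ₜ ℝ × NNReal)

/-- The boundary of a surface: the points without a neighbourhood homeomorphic to the plane. -/
def surfaceBoundary (X : Type*) [TopologicalSpace X] : Set X :=
  {x | ¬ ∃ U ∈ 𝓝 x, Nonempty (U ≃ₜ ℝ × ℝ)}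

/-- `B` is collared in `X`: there is an embedding `h : B × [0,1] → X` with `h (x, 0) = x`, with
`h ⁻¹ (B) = B × {0}`, and such that `h (B × [0,1))` is open in `X`. -/
def IsCollared {X : Type*} [TopologicalSpace X] (B : Set X) : Prop :=
  ∃ h : B × unitInterval → X, IsEmbedding h ∧ (∀ x : B, h (x, 0) = x) ∧
    h ⁻¹' B = {p | p.2 = 0} ∧ IsOpen (h '' {p | p.2 < 1})

/-- A zero-set: the preimage of `0` under a continuous real-valued function. -/
def IsZeroSet {X : Type*} [TopologicalSpace X] (A : Set X) : Prop :=
  ∃ f : X → ℝ, Continuous f ∧ A = f ⁻¹' {0}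

/-! ### The long ray -/

/-- The closed long ray: `ω₁ × [0,1)`, ordered lexicographically. -/
def LongRay : Type 1 :=
  (Iio (Ordinal.omega.{0} 1)) ×ₗ (Ico (0 : ℝ) 1)

instance : LinearOrder LongRay :=
  inferInstanceAs (LinearOrder ((Iio (Ordinal.omega.{0} 1)) ×ₗ (Ico (0 : ℝ) 1)))

instance : TopologicalSpace LongRay := Preorder.topology LongRay

instance : OrderTopology LongRay := ⟨rfl⟩

/-- A countable ordinal `α`, seen as the point `⟨α, 0⟩` of the long ray. -/
def LongRay.ofOrdinal (α : Ordinal.{0}) (h : α < Ordinal.omega.{0} 1) : LongRay :=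
  toLex (⟨α, h⟩, ⟨0, le_refl 0, zero_lt_one⟩)

/-- The endpoint of the closed long ray. -/
instance : Zero LongRay := ⟨LongRay.ofOrdinal 0 (Ordinal.omega_pos 1)⟩

/-- The countable limit ordinals (`0` is not a limit). -/
def CountableLimit : Type 1 :=
  {α : Ordinal.{0} // α < Ordinal.omega.{0} 1 ∧ IsSuccLimit α}

/-- The point `α` of the long ray, for a countable limit ordinal `α`. -/
def CountableLimit.pt (α : CountableLimit) : LongRay :=
  LongRay.ofOrdinal α.1 α.2.1

/-- The point `α + 1` of the long ray, for a countable limit ordinal `α`. -/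
def CountableLimit.next (α : CountableLimit) : LongRay :=
  LongRay.ofOrdinal (succ α.1) ((Cardinal.isSuccLimit_omega 1).succ_lt α.2.1)

theorem CountableLimit.pt_mem (α : CountableLimit) : α.pt ∈ Ioo (0 : LongRay) α.next := by
  constructor
  · refine Prod.Lex.toLex_lt_toLex.2 (Or.inl ?_)
    exact Subtype.mk_lt_mk.2 (pos_iff_ne_zero.2 fun h => by
      have := α.2.2.1
      rw [h] at this
      exact this isMin_bot)
  · refine Prod.Lex.toLex_lt_toLex.2 (Or.inl ?_)
    exact Subtype.mk_lt_mk.2 (lt_succ α.1)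

/-! ### Prüferising the octant on the diagonal -/

/-- An increasing homeomorphism `Φ` from the interval `(0, α + 1)` of the long ray onto the real
interval `(0, 2)` that sends `α` to `1`. (An order isomorphism of intervals is a homeomorphism.)
Its square sends the part `y < x` of `(0, α + 1)²` to the part `y < x` of `(0, 2)²` and carries
`⟨α, α⟩` to `⟨1, 1⟩`. -/
structure DiagonalChart (α : CountableLimit) where
  /-- the homeomorphism -/
  iso : Ioo (0 : LongRay) α.next ≃o Ioo (0 : ℝ) 2
  map_pt : (iso ⟨α.pt, α.pt_mem⟩ : ℝ) = 1

/-- The long-ray octant without its boundary: the pairs `⟨x, y⟩` with `0 < y < x`. -/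
def OpenOctant : Type 1 := {p : LongRay × LongRay // 0 < p.2 ∧ p.2 < p.1}

instance : TopologicalSpace OpenOctant :=
  inferInstanceAs (TopologicalSpace {p : LongRay × LongRay // 0 < p.2 ∧ p.2 < p.1})

/-- The wedge in the octant that points at `⟨α, α⟩`, in the coordinates given by `Φ`.

In the half plane `y ≤ x` use the linear coordinates `s = x - y` (so that the diagonal is `s = 0`)
and `t = x - 1` centred at `⟨1, 1⟩`. The line `t = m s` through `⟨1, 1⟩` has slope `m`, and the
line of slope `0` is the vertical line. The wedge lies between the lines of slopes `u` and `v`,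
and between `s = 0` and `s = w`. -/
def wedge {α : CountableLimit} (Φ : DiagonalChart α) (u v w : ℝ) : Set OpenOctant :=
  {p | ∃ (hx : p.1.1 ∈ Ioo (0 : LongRay) α.next) (hy : p.1.2 ∈ Ioo (0 : LongRay) α.next),
    let x : ℝ := Φ.iso ⟨p.1.1, hx⟩
    let y : ℝ := Φ.iso ⟨p.1.2, hy⟩
    u * (x - y) < x - 1 ∧ x - 1 < v * (x - y) ∧ x - y < w}

/-- The octant Prüferised at the points `⟨α, α⟩` of the diagonal with `α` a countable limit
ordinal, the rest of its boundary being deleted: a copy of the real line is attached to the open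
octant for every such `α`. The family `Φ` of coordinates only enters in the topology. -/
inductive PruferOctant (Φ : ∀ α : CountableLimit, DiagonalChart α) : Type 1
  /-- a point of the open octant -/
  | inner (p : OpenOctant) : PruferOctant Φ
  /-- the point `r` of the real line attached at `⟨α, α⟩` -/
  | line (α : CountableLimit) (r : ℝ) : PruferOctant Φ

namespace PruferOctant

/-- The topology: the open octant is an open subspace, and a neighbourhood base at the point `r` of
the line attached at `⟨α, α⟩` is given by the unions of an interval `(u, v) ∋ r` of that line and
of the wedge of slopes `u`, `v` and some width `w > 0`. -/
instance (Φ : ∀ α : CountableLimit, DiagonalChart α) : TopologicalSpace (PruferOctant Φ) where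
  IsOpen U := IsOpen (inner ⁻¹' U) ∧ ∀ α r, line α r ∈ U →
    ∃ u v w : ℝ, u < r ∧ r < v ∧ 0 < w ∧
      (∀ q ∈ Ioo u v, line α q ∈ U) ∧ ∀ p ∈ wedge (Φ α) u v w, inner p ∈ U
  isOpen_univ := ⟨isOpen_univ, fun _ r _ =>
    ⟨r - 1, r + 1, 1, by linarith, by linarith, one_pos, fun _ _ => trivial, fun _ _ => trivial⟩⟩
  isOpen_inter := by
    rintro U V ⟨hU, hU'⟩ ⟨hV, hV'⟩
    refine ⟨hU.inter hV, fun α r hr => ?_⟩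
    obtain ⟨u, v, w, hu, hv, hw, h1, h2⟩ := hU' α r hr.1
    obtain ⟨u', v', w', hu', hv', hw', h1', h2'⟩ := hV' α r hr.2
    refine ⟨max u u', min v v', min w w', max_lt hu hu', lt_min hv hv', lt_min hw hw', ?_, ?_⟩
    · intro q hq
      exact ⟨h1 q ⟨(le_max_left _ _).trans_lt hq.1, hq.2.trans_le (min_le_left _ _)⟩,
        h1' q ⟨(le_max_right _ _).trans_lt hq.1, hq.2.trans_le (min_le_right _ _)⟩⟩
    · rintro p ⟨hx, hy, h3, h4, h5⟩
      have hs : (0 : ℝ) ≤ (Φ α).iso ⟨p.1.1, hx⟩ - (Φ α).iso ⟨p.1.2, hy⟩ :=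
        sub_nonneg.2 ((Φ α).iso.monotone (Subtype.mk_le_mk.2 p.2.2.le))
      refine ⟨h2 p ⟨hx, hy, ?_, ?_, ?_⟩, h2' p ⟨hx, hy, ?_, ?_, ?_⟩⟩
      · exact (mul_le_mul_of_nonneg_right (le_max_left _ _) hs).trans_lt h3
      · exact h4.trans_le (mul_le_mul_of_nonneg_right (min_le_left _ _) hs)
      · exact h5.trans_le (min_le_left _ _)
      · exact (mul_le_mul_of_nonneg_right (le_max_right _ _) hs).trans_lt h3
      · exact h4.trans_le (mul_le_mul_of_nonneg_right (min_le_right _ _) hs)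
      · exact h5.trans_le (min_le_right _ _)
  isOpen_sUnion := by
    intro 𝒰 h𝒰
    refine ⟨?_, ?_⟩
    · rw [preimage_sUnion]
      exact isOpen_biUnion fun U hU => (h𝒰 U hU).1
    · rintro α r ⟨U, hU, hr⟩
      obtain ⟨u, v, w, hu, hv, hw, h1, h2⟩ := (h𝒰 U hU).2 α r hr
      exact ⟨u, v, w, hu, hv, hw, fun q hq => ⟨U, hU, h1 q hq⟩, fun p hp => ⟨U, hU, h2 p hp⟩⟩

/-- The union of the attached lines. -/
def lines (Φ : ∀ α : CountableLimit, DiagonalChart α) : Set (PruferOctant Φ) :=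
  {z | ∃ α r, z = line α r}

/-- The set of the zero points of the attached lines. -/
def zeros (Φ : ∀ α : CountableLimit, DiagonalChart α) : Set (PruferOctant Φ) :=
  {z | ∃ α, z = line α 0}

end PruferOctant

end

/-! Near `⟨α, α⟩` use the slope `m = (x' - 1) / (x' - y')` and the width `s = x' - y'`. The wedge at
`α` lies over the box `u < m < v`, `0 < s < w`, and the attached line is the missing edge `s = 0`.
So the line and the part `s (|m| + 2) < 1` of the octant below `α + 1` form a half plane
(`isOpenEmbedding_lineChart`). That no point of the line has a planar neighbourhood follows from
covering theory: the inverse of a planar chart would have a logarithm on a punctured half disc,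
which is simply connected, and this would give a continuous logarithm on a circle around `0`.

The heart is that `D` is not a Gδ set. An open `U ⊇ D` contains the top of the vertical line below
every `⟨α, α⟩`, because the slope `0` lies inside the wedge. If arbitrarily high horizontal lines
left `U` arbitrarily far to the right, closing off under the choice of such lines and points would
give a limit `α` for which points outside `U` on one horizontal line converge to a point of that
vertical piece. Hence all high horizontal lines have a tail in `U` (`exists_forall_tail_subset`). As
countable sets are bounded in the long ray, countably many such `U` share a point of the octant
(`not_isGδ_zeros`).

Zero-sets are Gδ. A collar would make `D` a Gδ set as well: `D × {0}` is closed, hence Gδ, in the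
metrisable space `∂S × [0,1]`, and the collar carries this to `S` (`IsCollared.isGδ`). -/

noncomputable section

/-! ### Invariance of the boundary in dimension two -/

/-- A point with a planar neighbourhood has arbitrarily small ones, centred at it. -/
theorem exists_isEmbedding_of_homeomorph_plane {X : Type*} [TopologicalSpace X] {x : X}
    {N W : Set X} (hN : N ∈ 𝓝 x) (e : N ≃ₜ ℝ × ℝ) (hW : W ∈ 𝓝 x) :
    ∃ f : ℝ × ℝ → X, IsEmbedding f ∧ f 0 = x ∧ range f ⊆ W ∧ range f ∈ 𝓝 x := by
  set g : ℝ × ℝ → X := fun z => (e.symm z : X) with hg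
  have hgE : IsEmbedding g := IsEmbedding.subtypeVal.comp e.symm.isEmbedding
  set c := e ⟨x, mem_of_mem_nhds hN⟩ with hc
  have hgc : g c = x := by simp [hg, hc]
  have hrange : range g = N := by
    ext y
    constructor
    · rintro ⟨z, rfl⟩
      exact (e.symm z).2
    · intro hy
      exact ⟨e ⟨y, hy⟩, by simp [hg]⟩
  have hgW : g ⁻¹' W ∈ 𝓝 c := hgE.continuous.continuousAt (by rw [hgc]; exact hW)
  obtain ⟨ρ, hρ, hball⟩ := Metric.mem_nhds_iff.1 hgW
  have hb : IsOpenEmbedding (OpenPartialHomeomorph.univBall c ρ) :=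
    OpenPartialHomeomorph.isOpenEmbedding _ (OpenPartialHomeomorph.univBall_source c ρ)
  have hbr : range (OpenPartialHomeomorph.univBall c ρ) = Metric.ball c ρ := by
    rw [← image_univ, ← OpenPartialHomeomorph.univBall_source c ρ,
      OpenPartialHomeomorph.image_source_eq_target, OpenPartialHomeomorph.univBall_target c hρ]
  refine ⟨g ∘ OpenPartialHomeomorph.univBall c ρ, hgE.comp hb.isEmbedding, ?_, ?_, ?_⟩
  · simp [hgc]
  · rw [range_comp, hbr]
    exact image_subset_iff.2 hball
  -- `N` need not be open, so `g` need not be an open map; it still carries neighbourhoods of `c` to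
  -- neighbourhoods of `x`, because its range is one.
  · rw [range_comp, hbr, ← hgc, ← hgE.isInducing.map_nhds_of_mem c (by rw [hgc, hrange]; exact hN)]
    exact Filter.image_mem_map (Metric.ball_mem_nhds c hρ)

/-- There is no continuous logarithm along a circle around the origin. -/
theorem not_exists_continuous_log_circle {δ : ℝ} (M : ℝ → ℂ) (hM : Continuous M)
    (hexp : ∀ θ : ℝ, Complex.exp (M θ) = δ * Complex.exp (θ * Complex.I))
    (hper : M (2 * Real.pi) = M 0) : False := by
  have h2 : Continuous fun θ : ℝ => M 0 + θ * Complex.I := by fun_prop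
  -- Both functions lift the same path through the covering `exp` and agree at `0`, but the second
  -- one gains `2πi` over a period.
  have key := Complex.isCoveringMap_exp.eq_of_comp_eq hM h2 (by
    funext θ
    apply Subtype.ext
    have h0 := hexp 0
    simp only [Complex.ofReal_zero, zero_mul, Complex.exp_zero, mul_one] at h0
    simp only [Function.comp, Complex.exp_add, hexp θ, h0]) 0 (by simp)
  have h3 := congrFun key (2 * Real.pi)
  rw [hper] at h3
  have h4 := congrArg Complex.im h3
  simp at h4

/-- Invariance of the boundary: a boundary point of the half plane has no neighbourhood in it that
is the image of an embedding of the plane. -/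
theorem not_isEmbedding_range_mem_nhds_halfPlane {r : ℝ} (f : ℂ → ℝ × NNReal)
    (hf : IsEmbedding f) (h0 : f 0 = (r, 0)) (hr : range f ∈ 𝓝 ((r, 0) : ℝ × NNReal)) :
    False := by
  -- The map `k` identifies the half plane with the closed right half plane, `(r, 0)` going to `0`;
  -- `j` extends its inverse to all of `ℂ`.
  set j : ℂ → ℝ × NNReal := fun z => (r + z.im, Real.toNNReal z.re) with hj
  have hjc : Continuous j := by
    refine Continuous.prodMk (by fun_prop) (continuous_real_toNNReal.comp Complex.continuous_re)
  set k : ℝ × NNReal → ℂ := fun p => ⟨(p.2 : ℝ), p.1 - r⟩ with hk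
  have hkc : Continuous k := by
    have : k = fun p => ((p.2 : ℝ) : ℂ) + ((p.1 - r : ℝ) : ℂ) * Complex.I := by
      funext p
      apply Complex.ext <;> simp [hk]
    rw [this]
    fun_prop
  have hjk : ∀ p, j (k p) = p := by
    rintro ⟨a, b⟩
    simp [hj, hk]
  have hj0 : j 0 = (r, 0) := by simp [hj]
  have hk0 : k (r, 0) = 0 := by apply Complex.ext <;> simp [hk]
  have hjr : j ⁻¹' range f ∈ 𝓝 (0 : ℂ) := hjc.continuousAt (by rw [hj0]; exact hr)
  obtain ⟨ρ, hρ, hball⟩ := Metric.mem_nhds_iff.1 hjr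
  -- The exponential maps this convex strip onto the punctured closed right half disc of radius `ρ`.
  set K : Set ℂ := {w | w.re < Real.log ρ ∧ -(Real.pi / 2) ≤ w.im ∧ w.im ≤ Real.pi / 2} with hK
  have hKconv : Convex ℝ K := by
    have e : K = Complex.reLm ⁻¹' (Iio (Real.log ρ)) ∩
        Complex.imLm ⁻¹' (Icc (-(Real.pi / 2)) (Real.pi / 2)) := by
      ext w
      simp [hK]
    rw [e]
    exact ((convex_Iio _).linear_preimage _).inter ((convex_Icc _ _).linear_preimage _)
  have hKne : K.Nonempty := by
    refine ⟨((Real.log ρ - 1 : ℝ) : ℂ), ?_, ?_, ?_⟩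
    · simp
    · simpa using Real.pi_div_two_pos.le
    · simpa using Real.pi_div_two_pos.le
  have hKball : ∀ w ∈ K, j (Complex.exp w) ∈ range f := by
    intro w hw
    refine hball ?_
    rw [mem_ball_zero_iff, Complex.norm_exp]
    calc Real.exp w.re < Real.exp (Real.log ρ) := Real.exp_lt_exp.2 hw.1
      _ = ρ := Real.exp_log hρ
  set fe := hf.toHomeomorph with hfe
  let F : C(K, ℂ) := ⟨fun w => fe.symm ⟨j (Complex.exp w), hKball w w.2⟩, by
    refine fe.symm.continuous.comp (Continuous.subtype_mk ?_ _)
    exact hjc.comp (Complex.continuous_exp.comp continuous_subtype_val)⟩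
  have hF : ∀ w, f (F w) = j (Complex.exp w) := by
    intro w
    have : fe (F w) = ⟨j (Complex.exp w), hKball w w.2⟩ := fe.apply_symm_apply _
    exact congrArg Subtype.val this
  have hF0 : ∀ w, F w ∈ ({0}ᶜ : Set ℂ) := by
    intro w hw
    have h1 := hF w
    rw [mem_singleton_iff.1 hw, h0] at h1
    simp only [hj, Prod.mk.injEq, left_eq_add] at h1
    have hre : 0 ≤ (Complex.exp w).re := by
      rw [Complex.exp_re]
      exact mul_nonneg (Real.exp_pos _).le (Real.cos_nonneg_of_mem_Icc w.2.2)
    have h2 := Real.toNNReal_eq_zero.1 h1.2.symm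
    exact Complex.exp_ne_zero w (Complex.ext (le_antisymm h2 hre) h1.1)
  have : ContractibleSpace K := hKconv.contractibleSpace hKne
  have : LocallyPathConnectedSpace K := hKconv.locallyPathConnectedSpace
  obtain ⟨w0, hw0⟩ := hKne
  -- `F` is the inverse of `f` on the punctured half disc, in logarithmic coordinates. It avoids `0`
  -- and its domain is convex, so it has a logarithm `L`.
  obtain ⟨L, ⟨-, hL⟩, -⟩ := Complex.isCoveringMapOn_exp.existsUnique_continuousMap_lifts F
    (a₀ := ⟨w0, hw0⟩) (e₀ := Complex.log (F ⟨w0, hw0⟩)) (Complex.exp_log (hF0 _)) hF0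
  have hkf : (fun z => k (f z)) ⁻¹' Metric.ball 0 ρ ∈ 𝓝 (0 : ℂ) :=
    (hkc.comp hf.continuous).continuousAt (by
      simp only [Function.comp, h0, hk0]
      exact Metric.ball_mem_nhds _ hρ)
  obtain ⟨δ', hδ', hball'⟩ := Metric.mem_nhds_iff.1 hkf
  set δ := δ' / 2 with hδ
  have hδpos : 0 < δ := half_pos hδ'
  set ζ : ℝ → ℂ := fun θ => δ * Complex.exp (θ * Complex.I) with hζ
  have hζc : Continuous ζ := by fun_prop
  have hζn : ∀ θ, ‖ζ θ‖ = δ := by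
    intro θ
    simp [hζ, Complex.norm_exp_ofReal_mul_I, abs_of_pos hδpos]
  have hkne : ∀ θ, k (f (ζ θ)) ≠ 0 := by
    intro θ h
    have h1 : f (ζ θ) = f 0 := by rw [h0, ← hjk (f (ζ θ)), h, hj0]
    have h2 := hζn θ
    rw [hf.injective h1, norm_zero] at h2
    exact hδpos.ne h2
  have hkre : ∀ p, 0 ≤ (k p).re := fun p => p.2.2
  have hslit : ∀ θ, k (f (ζ θ)) ∈ Complex.slitPlane := by
    intro θ
    rw [Complex.mem_slitPlane_iff]
    rcases (hkre (f (ζ θ))).lt_or_eq with h | h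
    · exact Or.inl h
    · exact Or.inr fun h' => hkne θ (Complex.ext h.symm h')
  have hlogK : ∀ θ, Complex.log (k (f (ζ θ))) ∈ K := by
    intro θ
    refine ⟨?_, ?_⟩
    · rw [Complex.log_re]
      refine Real.log_lt_log (norm_pos_iff.2 (hkne θ)) ?_
      have : ζ θ ∈ Metric.ball (0 : ℂ) δ' := by
        rw [mem_ball_zero_iff, hζn]
        exact half_lt_self hδ'
      simpa using hball' this
    · rw [Complex.log_im, ← abs_le]
      exact Complex.abs_arg_le_pi_div_two_iff.2 (hkre _)
  -- On the circle `ζ` the principal logarithm of `k ∘ f` is continuous with values in `K`; feeding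
  -- it to `L` gives a periodic logarithm of `ζ`.
  refine not_exists_continuous_log_circle (δ := δ)
    (fun θ => L ⟨Complex.log (k (f (ζ θ))), hlogK θ⟩) ?_ ?_ ?_
  · refine L.continuous.comp (Continuous.subtype_mk ?_ _)
    exact (hkc.comp (hf.continuous.comp hζc)).clog hslit
  · intro θ
    have h1 := congrFun hL ⟨Complex.log (k (f (ζ θ))), hlogK θ⟩
    simp only [Function.comp] at h1
    rw [h1]
    apply hf.injective
    rw [hF]
    simp only
    rw [Complex.exp_log (hkne θ), hjk]
  · have : ζ (2 * Real.pi) = ζ 0 := by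
      simp [hζ, Complex.exp_two_pi_mul_I]
    simp only [this]

/-- A boundary point of the half plane, in an open half-plane chart, has no planar
neighbourhood. -/
theorem not_exists_nhds_homeomorph_plane {X : Type*} [TopologicalSpace X]
    {ψ : ℝ × NNReal → X} (hψ : IsOpenEmbedding ψ) (r : ℝ) :
    ¬ ∃ U ∈ 𝓝 (ψ (r, 0)), Nonempty (U ≃ₜ ℝ × ℝ) := by
  rintro ⟨U, hU, ⟨e⟩⟩
  obtain ⟨f, hf, hf0, hfs, hfr⟩ := exists_isEmbedding_of_homeomorph_plane hU e
    (hψ.isOpen_range.mem_nhds (mem_range_self (r, (0 : NNReal))))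
  choose g hg using fun z => hfs (mem_range_self z)
  have hgf : ψ ∘ g = f := funext hg
  have hgE : IsEmbedding g := by
    rw [← hgf] at hf
    exact (hψ.isEmbedding.of_comp_iff).1 hf
  let E : ℂ ≃ₜ ℝ × ℝ := Complex.equivRealProdCLM.toHomeomorph
  refine not_isEmbedding_range_mem_nhds_halfPlane (r := r) (g ∘ E) (hgE.comp E.isEmbedding) ?_ ?_
  · apply hψ.injective
    have : E 0 = 0 := map_zero Complex.equivRealProdCLM
    simp only [Function.comp, this]
    rw [hg, hf0]
  · rw [range_comp, E.surjective.range_eq, image_univ]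
    have : range g = ψ ⁻¹' range f := by
      rw [← hgf, range_comp, preimage_image_eq _ hψ.injective]
    rw [this]
    exact hψ.continuous.continuousAt hfr

/-- A point with a planar neighbourhood has a neighbourhood homeomorphic to the half plane. -/
theorem exists_nhds_homeomorph_halfPlane_of_plane {X : Type*} [TopologicalSpace X] {x : X}
    (h : ∃ U ∈ 𝓝 x, Nonempty (U ≃ₜ ℝ × ℝ)) : ∃ U ∈ 𝓝 x, Nonempty (U ≃ₜ ℝ × NNReal) := by
  obtain ⟨U, hU, ⟨e⟩⟩ := h
  obtain ⟨f, hf, hf0, -, hfr⟩ := exists_isEmbedding_of_homeomorph_plane hU e Filter.univ_mem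
  -- Lowering the half plane by `1` puts the origin into its interior.
  set i : ℝ × NNReal → ℝ × ℝ := fun p => (p.1, (p.2 : ℝ) - 1) with hi
  have hiE : IsEmbedding i := by
    have h1 : IsEmbedding (Subtype.val : NNReal → ℝ) := IsEmbedding.subtypeVal
    have h2 : IsEmbedding (fun t : NNReal => (t : ℝ) - 1) :=
      (Homeomorph.subRight (1 : ℝ)).isEmbedding.comp h1
    exact IsEmbedding.id.prodMap h2
  have hir : range i ∈ 𝓝 (0 : ℝ × ℝ) := by
    have : {p : ℝ × ℝ | -1 < p.2} ∈ 𝓝 (0 : ℝ × ℝ) :=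
      (isOpen_lt continuous_const continuous_snd).mem_nhds (by simp)
    refine Filter.mem_of_superset this ?_
    rintro ⟨a, b⟩ hb
    have hb' : (-1 : ℝ) < b := hb
    refine ⟨(a, ⟨b + 1, by linarith⟩), Prod.ext rfl ?_⟩
    exact add_sub_cancel_right b 1
  refine ⟨range (f ∘ i), ?_, ⟨(hf.comp hiE).toHomeomorph.symm⟩⟩
  rw [range_comp, ← hf0, ← hf.isInducing.map_nhds_of_mem 0 (by rw [hf0]; exact hfr)]
  exact Filter.image_mem_map hir

/-! ### Coordinates on the long ray -/

namespace LongRay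

/-- The ordinal part of a point of the long ray. -/
def ord (z : LongRay) : Ordinal.{0} := (ofLex z).1.1

/-- The fractional part of a point of the long ray. -/
def frac (z : LongRay) : ℝ := (ofLex z).2.1

/-- The point of the long ray with given ordinal and fractional parts. -/
def mk (β : Ordinal.{0}) (hβ : β < Ordinal.omega 1) (t : ℝ) (ht : t ∈ Ico (0 : ℝ) 1) : LongRay :=
  toLex (⟨β, hβ⟩, ⟨t, ht⟩)

theorem ord_lt (z : LongRay) : z.ord < Ordinal.omega 1 := (ofLex z).1.2

theorem frac_mem (z : LongRay) : z.frac ∈ Ico (0 : ℝ) 1 := (ofLex z).2.2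

@[simp] theorem ord_zero : (0 : LongRay).ord = 0 := rfl

@[simp] theorem frac_zero : (0 : LongRay).frac = 0 := rfl

theorem lt_iff {z z' : LongRay} : z < z' ↔ z.ord < z'.ord ∨ z.ord = z'.ord ∧ z.frac < z'.frac := by
  refine (Prod.Lex.lt_iff (x := z) (y := z')).trans ?_
  refine or_congr Iff.rfl (and_congr ?_ Iff.rfl)
  exact Subtype.ext_iff

theorem lt_ofOrdinal_iff {z : LongRay} {β : Ordinal.{0}} {h} : z < ofOrdinal β h ↔ z.ord < β := by
  rw [lt_iff]
  constructor
  · rintro (h1 | h1)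
    · exact h1
    · exact absurd h1.2 (not_lt.2 z.frac_mem.1)
  · exact Or.inl

theorem ofOrdinal_le_iff {z : LongRay} {β : Ordinal.{0}} {h} : ofOrdinal β h ≤ z ↔ β ≤ z.ord := by
  rw [← not_lt, lt_ofOrdinal_iff, not_lt]

theorem zero_le (z : LongRay) : 0 ≤ z := ofOrdinal_le_iff.2 bot_le

theorem pos_iff {z : LongRay} : 0 < z ↔ z.ord ≠ 0 ∨ z.frac ≠ 0 := by
  rw [lt_iff, ord_zero, frac_zero]
  constructor
  · rintro (h | h)
    · exact Or.inl h.ne'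
    · exact Or.inr h.2.ne'
  · rintro (h | h)
    · exact Or.inl (pos_iff_ne_zero.2 h)
    · by_cases h0 : z.ord = 0
      · exact Or.inr ⟨h0.symm, lt_of_le_of_ne z.frac_mem.1 h.symm⟩
      · exact Or.inl (pos_iff_ne_zero.2 h0)

end LongRay

/-! ### Existence of the charts -/

theorem countable_Iio_of_lt_omega_one {α : Ordinal.{0}} (hα : α < Ordinal.omega 1) :
    (Iio α).Countable := by
  rw [← Cardinal.le_aleph0_iff_set_countable, Cardinal.mk_Iio_ordinal, Cardinal.lift_le_aleph0,
    ← Cardinal.lt_aleph_one_iff, ← Cardinal.lt_ord, Cardinal.ord_aleph]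
  exact hα

/-- The partial sums of a family of reals indexed by the ordinals. -/
def partialSum (c : Ordinal.{0} → ℝ) (β : Ordinal.{0}) : ℝ := ∑' γ, (Iio β).indicator c γ

section partialSum

variable {c : Ordinal.{0} → ℝ}

theorem partialSum_zero : partialSum c 0 = 0 := by
  simp [partialSum]

theorem partialSum_mono (hc : Summable c) (h0 : ∀ γ, 0 ≤ c γ) : Monotone (partialSum c) := by
  intro β β' h
  refine (hc.indicator _).tsum_le_tsum (fun γ => ?_) (hc.indicator _)
  exact indicator_le_indicator_of_subset (Iio_subset_Iio h) h0 γ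

theorem partialSum_succ (hc : Summable c) (β : Ordinal.{0}) :
    partialSum c (succ β) = partialSum c β + c β := by
  have h1 : (Iio (succ β)).indicator c = (Iio β).indicator c + Pi.single β (c β) := by
    funext γ
    by_cases h : γ = β
    · subst h
      simp
    · have : γ < succ β ↔ γ < β := by
        rw [lt_succ_iff]
        exact ⟨fun h' => lt_of_le_of_ne h' h, le_of_lt⟩
      simp only [indicator, mem_Iio, this, Pi.add_apply, Pi.single_eq_of_ne h, add_zero]
  rw [partialSum, h1]
  simp only [Pi.add_apply]
  rw [(hc.indicator _).tsum_add (hasSum_pi_single β (c β)).summable,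
    (hasSum_pi_single β (c β)).tsum_eq, partialSum]

/-- This is continuity of the partial sums from the left at limits: some finite subsum already
exceeds `s`, and its largest index below `β` serves as `γ`. -/
theorem exists_lt_partialSum_succ (hc : Summable c) (h0 : ∀ γ, 0 ≤ c γ) {β : Ordinal.{0}} {s : ℝ}
    (hs0 : 0 ≤ s) (hs : s < partialSum c β) : ∃ γ < β, s < partialSum c (succ γ) := by
  obtain ⟨F, hF⟩ := ((hc.indicator (Iio β)).hasSum.eventually (lt_mem_nhds hs)).exists
  have hne : (F.filter fun γ => γ < β).Nonempty := by
    by_contra hne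
    rw [Finset.not_nonempty_iff_eq_empty, Finset.filter_eq_empty_iff] at hne
    rw [Finset.sum_eq_zero fun γ hγ => indicator_of_notMem (show γ ∉ Iio β from hne hγ) c] at hF
    exact absurd hF (not_lt.2 hs0)
  obtain ⟨m, hm, hmax⟩ : ∃ m < β, ∀ γ ∈ F, γ < β → γ ≤ m := by
    refine ⟨(F.filter fun γ => γ < β).max' hne, ?_, fun γ hγ h => Finset.le_max' _ _ ?_⟩
    · exact (Finset.mem_filter.1 (Finset.max'_mem _ hne)).2
    · exact Finset.mem_filter.2 ⟨hγ, h⟩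
  refine ⟨m, hm, ?_⟩
  refine hF.trans_le ?_
  calc ∑ γ ∈ F, (Iio β).indicator c γ
      ≤ ∑ γ ∈ F, (Iio (succ m)).indicator c γ := by
        refine Finset.sum_le_sum fun γ hγ => ?_
        by_cases h : γ < β
        · rw [indicator_of_mem (show γ ∈ Iio β from h), indicator_of_mem]
          exact mem_Iio.2 (lt_succ_iff.2 (hmax γ hγ h))
        · rw [indicator_of_notMem (show γ ∉ Iio β from h)]
          exact indicator_nonneg (fun γ _ => h0 γ) γ
    _ ≤ _ := (hc.indicator _).sum_le_tsum F fun γ _ => indicator_nonneg (fun γ _ => h0 γ) γ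

end partialSum

/-- Countability of `α` enters here: a countable set carries positive summable weights. They are
divided by their sum, and the weight `1` is put on `α` itself. -/
theorem exists_weights (α : CountableLimit) : ∃ c : Ordinal.{0} → ℝ, Summable c ∧
    (∀ γ, 0 ≤ c γ) ∧ (∀ γ ≤ α.1, 0 < c γ) ∧ partialSum c α.1 = 1 ∧ c α.1 = 1 := by
  obtain ⟨ε, hε, s, hs, -⟩ := (countable_Iio_of_lt_omega_one α.2.1).exists_pos_hasSum_le one_pos
  have hα0 : (0 : Ordinal) < α.1 := pos_iff_ne_zero.2 fun h => by
    have := α.2.2.1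
    rw [h] at this
    exact this isMin_bot
  have hs' : HasSum ((Iio α.1).indicator ε) s := hasSum_subtype_iff_indicator.1 hs
  have hspos : 0 < s := (hε 0).trans_le <| by
    have := le_hasSum hs' 0 fun γ _ => indicator_nonneg (fun γ _ => (hε γ).le) γ
    rwa [indicator_of_mem (show (0 : Ordinal) ∈ Iio α.1 from hα0)] at this
  set c : Ordinal.{0} → ℝ :=
    (fun γ => (Iio α.1).indicator ε γ / s) + Pi.single α.1 1 with hc
  have hlt : ∀ γ < α.1, c γ = ε γ / s := fun γ hγ => by
    simp [hc, hγ, hγ.ne]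
  have heq : c α.1 = 1 := by simp [hc]
  refine ⟨c, (hs'.summable.div_const s).add (hasSum_pi_single α.1 (1 : ℝ)).summable,
    fun γ => ?_, fun γ hγ => ?_, ?_, heq⟩
  · refine add_nonneg (div_nonneg (indicator_nonneg (fun γ _ => (hε γ).le) γ) hspos.le) ?_
    exact (Pi.single_nonneg.2 zero_le_one : (0 : Ordinal → ℝ) ≤ Pi.single α.1 1) γ
  · rcases hγ.lt_or_eq with h | h
    · rw [hlt γ h]
      exact div_pos (hε γ) hspos
    · rw [h, heq]
      exact one_pos
  · have : (Iio α.1).indicator c = fun γ => (Iio α.1).indicator ε γ / s := by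
      funext γ
      by_cases h : γ < α.1
      · simp [h, hlt γ h]
      · simp [h]
    rw [partialSum, this, (hs'.div_const s).tsum_eq, div_self hspos.ne']

/-- The interval `(0, α + 1)` of the long ray is isomorphic to `(0, 2)`: give the unit interval at
`γ ≤ α` a length, so that the lengths below `α` add up to `1`. -/
theorem nonempty_diagonalChart (α : CountableLimit) : Nonempty (DiagonalChart α) := by
  obtain ⟨c, hc, h0, hpos, hα, hcα⟩ := exists_weights α
  have hmono := partialSum_mono hc h0
  have hsucc := partialSum_succ hc
  set g : LongRay → ℝ := fun z => partialSum c z.ord + z.frac * c z.ord with hg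
  have hle : ∀ z ∈ Ioo (0 : LongRay) α.next, z.ord ≤ α.1 := fun z hz =>
    lt_succ_iff.1 (LongRay.lt_ofOrdinal_iff.1 hz.2)
  have hlow : ∀ z, partialSum c z.ord ≤ g z := fun z =>
    le_add_of_nonneg_right (mul_nonneg z.frac_mem.1 (h0 _))
  have hupp : ∀ z ∈ Ioo (0 : LongRay) α.next, g z < partialSum c (succ z.ord) := fun z hz => by
    rw [hsucc]
    have := mul_lt_mul_of_pos_right z.frac_mem.2 (hpos _ (hle z hz))
    simp only [hg]
    linarith
  have htop : partialSum c (succ α.1) = 2 := by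
    rw [hsucc, hα, hcα]
    norm_num
  have hgpos : ∀ z ∈ Ioo (0 : LongRay) α.next, 0 < g z := fun z hz => by
    rcases LongRay.pos_iff.1 hz.1 with h | h
    · have h1 := hmono (succ_le_of_lt (pos_iff_ne_zero.2 h))
      rw [hsucc, partialSum_zero] at h1
      have := hlow z
      have := hpos 0 bot_le
      linarith
    · have h1 := mul_pos (lt_of_le_of_ne z.frac_mem.1 h.symm) (hpos _ (hle z hz))
      have h2 := hmono (show (0 : Ordinal) ≤ z.ord from bot_le)
      rw [partialSum_zero] at h2
      simp only [hg]
      linarith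
  let G : Ioo (0 : LongRay) α.next → Ioo (0 : ℝ) 2 := fun z => ⟨g z, hgpos z z.2, by
    refine (hupp z z.2).trans_le ?_
    rw [← htop]
    exact hmono (succ_le_succ (hle z z.2))⟩
  have hG : StrictMono G := by
    rintro ⟨z, hz⟩ ⟨z', hz'⟩ hzz'
    refine Subtype.mk_lt_mk.2 ?_
    rcases LongRay.lt_iff.1 (Subtype.mk_lt_mk.1 hzz') with h | ⟨h, h'⟩
    · exact (hupp z hz).trans_le ((hmono (succ_le_of_lt h)).trans (hlow z'))
    · simp only [hg]
      rw [← h]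
      have := mul_lt_mul_of_pos_right h' (hpos _ (hle z hz))
      linarith
  have hsurj : Function.Surjective G := by
    rintro ⟨s, hs0, hs2⟩
    have hex : ∃ β, s < partialSum c (succ β) := ⟨α.1, by rwa [htop]⟩
    -- The least `β` whose unit interval ends beyond `s`; by left continuity of the partial sums
    -- that interval starts at or before `s`.
    set β := sInf {β | s < partialSum c (succ β)} with hβ
    have hβs : s < partialSum c (succ β) := csInf_mem hex
    have hβα : β ≤ α.1 := csInf_le' (by rwa [mem_ofPred_eq, htop])
    have hβl : partialSum c β ≤ s := by
      by_contra! h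
      obtain ⟨γ, hγ, h'⟩ := exists_lt_partialSum_succ hc h0 hs0.le h
      exact notMem_of_lt_csInf' hγ h'
    have hcβ := hpos β hβα
    rw [hsucc] at hβs
    let z := LongRay.mk β (hβα.trans_lt α.2.1) ((s - partialSum c β) / c β)
      ⟨div_nonneg (sub_nonneg.2 hβl) hcβ.le, by rw [div_lt_one hcβ]; linarith⟩
    have hgz : g z = s := by
      change partialSum c β + (s - partialSum c β) / c β * c β = s
      rw [div_mul_cancel₀ _ hcβ.ne']
      ring
    refine ⟨⟨z, LongRay.pos_iff.2 ?_, LongRay.lt_ofOrdinal_iff.2 (lt_succ_iff.2 hβα)⟩,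
      Subtype.ext hgz⟩
    by_contra! h
    have : g z = 0 := by simp only [hg, h.1, h.2, partialSum_zero, zero_mul, add_zero]
    exact hs0.ne (this.symm.trans hgz)
  refine ⟨⟨StrictMono.orderIsoOfSurjective G hG hsurj, ?_⟩⟩
  change partialSum c α.1 + 0 * c α.1 = 1
  rw [hα]
  ring

/-! ### Chart coordinates as continuous functions on the whole octant -/

namespace DiagonalChart

variable {α : CountableLimit} (Φ : DiagonalChart α)

/-- The monotone extension of a chart to the whole long ray. -/
def ext (x : LongRay) : ℝ :=
  if h : x ∈ Ioo (0 : LongRay) α.next then Φ.iso ⟨x, h⟩ else if x ≤ 0 then 0 else 2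

theorem ext_of_mem {x : LongRay} (h : x ∈ Ioo (0 : LongRay) α.next) :
    Φ.ext x = Φ.iso ⟨x, h⟩ := dif_pos h

theorem ext_mem_Ioo {x : LongRay} (h : x ∈ Ioo (0 : LongRay) α.next) :
    Φ.ext x ∈ Ioo (0 : ℝ) 2 := by
  rw [Φ.ext_of_mem h]
  exact (Φ.iso ⟨x, h⟩).2

theorem ext_of_next_le {x : LongRay} (h : α.next ≤ x) : Φ.ext x = 2 := by
  rw [ext, dif_neg fun h' => not_lt.2 h h'.2, if_neg]
  exact not_le.2 ((α.pt_mem.1.trans α.pt_mem.2).trans_le h)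

theorem ext_mem_Icc (x : LongRay) : Φ.ext x ∈ Icc (0 : ℝ) 2 := by
  by_cases h : x ∈ Ioo (0 : LongRay) α.next
  · exact Ioo_subset_Icc_self (Φ.ext_mem_Ioo h)
  · rw [ext, dif_neg h]
    split_ifs <;> simp

theorem ext_lt_ext {x y : LongRay} (hx : x ∈ Ioo (0 : LongRay) α.next)
    (hy : y ∈ Ioo (0 : LongRay) α.next) : Φ.ext x < Φ.ext y ↔ x < y := by
  rw [Φ.ext_of_mem hx, Φ.ext_of_mem hy, Subtype.coe_lt_coe, Φ.iso.lt_iff_lt, Subtype.mk_lt_mk]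

theorem ext_pt : Φ.ext α.pt = 1 := by
  rw [Φ.ext_of_mem α.pt_mem]
  exact Φ.map_pt

theorem monotone_ext : Monotone Φ.ext := by
  intro x y hxy
  rcases (LongRay.zero_le x).eq_or_lt with h0 | h0
  · have : Φ.ext x = 0 := by
      rw [ext, dif_neg fun h' => h'.1.ne h0, if_pos h0.symm.le]
    rw [this]
    exact (Φ.ext_mem_Icc y).1
  · rcases lt_or_ge y α.next with h | h
    · have hx : x ∈ Ioo (0 : LongRay) α.next := ⟨h0, hxy.trans_lt h⟩
      have hy : y ∈ Ioo (0 : LongRay) α.next := ⟨h0.trans_le hxy, h⟩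
      rw [← not_lt, Φ.ext_lt_ext hy hx, not_lt]
      exact hxy
    · rw [Φ.ext_of_next_le h]
      exact (Φ.ext_mem_Icc x).2

theorem exists_ext_eq {s : ℝ} (hs : s ∈ Ioo (0 : ℝ) 2) :
    ∃ x ∈ Ioo (0 : LongRay) α.next, Φ.ext x = s := by
  refine ⟨Φ.iso.symm ⟨s, hs⟩, (Φ.iso.symm ⟨s, hs⟩).2, ?_⟩
  rw [Φ.ext_of_mem (Φ.iso.symm ⟨s, hs⟩).2]
  simp

/-- A monotone map onto `[0, 2]` leaves no room for jumps. -/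
theorem continuous_ext : Continuous Φ.ext := by
  let f : LongRay → Icc (0 : ℝ) 2 := fun x => ⟨Φ.ext x, Φ.ext_mem_Icc x⟩
  have hm : Monotone f := fun x y h => Φ.monotone_ext h
  have hs : Function.Surjective f := by
    rintro ⟨s, hs0, hs2⟩
    rcases hs0.eq_or_lt with h | h
    · refine ⟨0, Subtype.ext ?_⟩
      change Φ.ext 0 = s
      rw [ext, dif_neg fun h' => h'.1.ne rfl, if_pos le_rfl, h]
    · rcases hs2.eq_or_lt with h' | h'
      · exact ⟨α.next, Subtype.ext ((Φ.ext_of_next_le le_rfl).trans h'.symm)⟩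
      · obtain ⟨x, -, hx⟩ := Φ.exists_ext_eq ⟨h, h'⟩
        exact ⟨x, Subtype.ext hx⟩
  exact continuous_subtype_val.comp (hm.continuous_of_surjective hs)

end DiagonalChart

/-- The triangle in the plane that corresponds to the part of the octant covered by a chart. -/
def openTriangle : Set (ℝ × ℝ) := {q | 0 < q.2 ∧ q.2 < q.1 ∧ q.1 < 2}

theorem isOpen_openTriangle : IsOpen openTriangle :=
  (isOpen_lt continuous_const continuous_snd).inter
    ((isOpen_lt continuous_snd continuous_fst).inter (isOpen_lt continuous_fst continuous_const))

namespace OpenOctant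

theorem isEmbedding_val : IsEmbedding (Subtype.val : OpenOctant → LongRay × LongRay) :=
  IsEmbedding.subtypeVal

theorem continuous_fst : Continuous fun p : OpenOctant => p.1.1 :=
  _root_.continuous_fst.comp isEmbedding_val.continuous

theorem continuous_snd : Continuous fun p : OpenOctant => p.1.2 :=
  _root_.continuous_snd.comp isEmbedding_val.continuous

theorem fst_pos (p : OpenOctant) : 0 < p.1.1 := p.2.1.trans p.2.2

instance : T2Space OpenOctant := isEmbedding_val.t2Space

end OpenOctant

namespace DiagonalChart

variable {α : CountableLimit} (Φ : DiagonalChart α)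

/-- The first coordinate on the octant. -/
def fst (p : OpenOctant) : ℝ := Φ.ext p.1.1

/-- The second coordinate on the octant. -/
def snd (p : OpenOctant) : ℝ := Φ.ext p.1.2

theorem continuous_fst : Continuous Φ.fst := Φ.continuous_ext.comp OpenOctant.continuous_fst

theorem continuous_snd : Continuous Φ.snd := Φ.continuous_ext.comp OpenOctant.continuous_snd

theorem snd_le_fst (p : OpenOctant) : Φ.snd p ≤ Φ.fst p := Φ.monotone_ext p.2.2.le

theorem snd_lt_fst {p : OpenOctant} (h : p.1.1 < α.next) : Φ.snd p < Φ.fst p :=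
  (Φ.ext_lt_ext ⟨p.2.1, p.2.2.trans h⟩ ⟨p.fst_pos, h⟩).2 p.2.2

theorem mem_openTriangle {p : OpenOctant} (h : p.1.1 < α.next) :
    (Φ.fst p, Φ.snd p) ∈ openTriangle :=
  ⟨(Φ.ext_mem_Ioo ⟨p.2.1, p.2.2.trans h⟩).1, Φ.snd_lt_fst h, (Φ.ext_mem_Ioo ⟨p.fst_pos, h⟩).2⟩

theorem mem_wedge_iff {u v w : ℝ} {p : OpenOctant} :
    p ∈ wedge Φ u v w ↔ p.1.1 < α.next ∧ u * (Φ.fst p - Φ.snd p) < Φ.fst p - 1 ∧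
      Φ.fst p - 1 < v * (Φ.fst p - Φ.snd p) ∧ Φ.fst p - Φ.snd p < w := by
  constructor
  · rintro ⟨hx, hy, h⟩
    refine ⟨hx.2, ?_⟩
    rw [fst, snd, Φ.ext_of_mem hx, Φ.ext_of_mem hy]
    exact h
  · rintro ⟨h1, h⟩
    have hx : p.1.1 ∈ Ioo (0 : LongRay) α.next := ⟨p.fst_pos, h1⟩
    have hy : p.1.2 ∈ Ioo (0 : LongRay) α.next := ⟨p.2.1, p.2.2.trans h1⟩
    refine ⟨hx, hy, ?_⟩
    rw [fst, snd, Φ.ext_of_mem hx, Φ.ext_of_mem hy] at h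
    exact h

theorem isOpen_lt_next : IsOpen {p : OpenOctant | p.1.1 < α.next} :=
  isOpen_lt OpenOctant.continuous_fst continuous_const

theorem isOpen_wedge (u v w : ℝ) : IsOpen (wedge Φ u v w) := by
  have h1 := Φ.continuous_fst
  have h2 := Φ.continuous_snd
  have : wedge Φ u v w = {p | p.1.1 < α.next} ∩ ({p | u * (Φ.fst p - Φ.snd p) < Φ.fst p - 1} ∩
      ({p | Φ.fst p - 1 < v * (Φ.fst p - Φ.snd p)} ∩ {p | Φ.fst p - Φ.snd p < w})) := by
    ext p
    exact Φ.mem_wedge_iff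
  rw [this]
  exact isOpen_lt_next.inter ((isOpen_lt (by fun_prop) (by fun_prop)).inter
    ((isOpen_lt (by fun_prop) (by fun_prop)).inter (isOpen_lt (by fun_prop) (by fun_prop))))

/-- The inverse of the coordinates of a chart. -/
def ofTriangle (q : openTriangle) : OpenOctant :=
  ⟨(Φ.iso.symm ⟨q.1.1, q.2.1.trans q.2.2.1, q.2.2.2⟩,
    Φ.iso.symm ⟨q.1.2, q.2.1, q.2.2.1.trans q.2.2.2⟩), (Φ.iso.symm _).2.1,
    Subtype.coe_lt_coe.2 (Φ.iso.symm.lt_iff_lt.2 (Subtype.mk_lt_mk.2 q.2.2.1))⟩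

theorem ofTriangle_fst_lt (q : openTriangle) : (Φ.ofTriangle q).1.1 < α.next :=
  (Φ.iso.symm ⟨q.1.1, q.2.1.trans q.2.2.1, q.2.2.2⟩).2.2

theorem fst_ofTriangle (q : openTriangle) : Φ.fst (Φ.ofTriangle q) = q.1.1 := by
  refine (Φ.ext_of_mem (Φ.iso.symm ⟨q.1.1, q.2.1.trans q.2.2.1, q.2.2.2⟩).2).trans ?_
  simp

theorem snd_ofTriangle (q : openTriangle) : Φ.snd (Φ.ofTriangle q) = q.1.2 := by
  refine (Φ.ext_of_mem (Φ.iso.symm ⟨q.1.2, q.2.1, q.2.2.1.trans q.2.2.2⟩).2).trans ?_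
  simp

theorem ofTriangle_coords {p : OpenOctant} (h : p.1.1 < α.next) :
    Φ.ofTriangle ⟨_, Φ.mem_openTriangle h⟩ = p := by
  have hx : p.1.1 ∈ Ioo (0 : LongRay) α.next := ⟨p.fst_pos, h⟩
  have hy : p.1.2 ∈ Ioo (0 : LongRay) α.next := ⟨p.2.1, p.2.2.trans h⟩
  refine Subtype.ext (Prod.ext ?_ ?_)
  · change (Φ.iso.symm _ : LongRay) = p.1.1
    have : (⟨Φ.fst p, Φ.ext_mem_Ioo hx⟩ : Ioo (0 : ℝ) 2) = Φ.iso ⟨p.1.1, hx⟩ :=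
      Subtype.ext (Φ.ext_of_mem hx)
    rw [this, OrderIso.symm_apply_apply]
  · change (Φ.iso.symm _ : LongRay) = p.1.2
    have : (⟨Φ.snd p, Φ.ext_mem_Ioo hy⟩ : Ioo (0 : ℝ) 2) = Φ.iso ⟨p.1.2, hy⟩ :=
      Subtype.ext (Φ.ext_of_mem hy)
    rw [this, OrderIso.symm_apply_apply]

theorem isOpenEmbedding_ofTriangle : IsOpenEmbedding Φ.ofTriangle := by
  have hc : Continuous Φ.ofTriangle := by
    refine Continuous.subtype_mk (Continuous.prodMk ?_ ?_) _
    · exact continuous_subtype_val.comp (Φ.iso.symm.continuous.comp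
        (Continuous.subtype_mk (_root_.continuous_fst.comp continuous_subtype_val) _))
    · exact continuous_subtype_val.comp (Φ.iso.symm.continuous.comp
        (Continuous.subtype_mk (_root_.continuous_snd.comp continuous_subtype_val) _))
  have hcomp : (fun p => (Φ.fst p, Φ.snd p)) ∘ Φ.ofTriangle = Subtype.val := by
    funext q
    exact Prod.ext (Φ.fst_ofTriangle q) (Φ.snd_ofTriangle q)
  refine ⟨IsEmbedding.of_comp hc (Φ.continuous_fst.prodMk Φ.continuous_snd) ?_, ?_⟩
  · rw [hcomp]
    exact IsEmbedding.subtypeVal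
  · have : range Φ.ofTriangle = {p | p.1.1 < α.next} := by
      ext p
      exact ⟨fun ⟨q, hq⟩ => hq ▸ Φ.ofTriangle_fst_lt q, fun h => ⟨_, Φ.ofTriangle_coords h⟩⟩
    rw [this]
    exact isOpen_lt_next

end DiagonalChart

/-- Every point of the image of an open set of the plane under an open embedding has a planar
neighbourhood. -/
theorem Topology.IsOpenEmbedding.exists_nhds_homeomorph_plane {X : Type*} [TopologicalSpace X]
    {T : Set (ℝ × ℝ)} (hT : IsOpen T) {f : T → X} (hf : IsOpenEmbedding f) (q : T) :
    ∃ U ∈ 𝓝 (f q), Nonempty (U ≃ₜ ℝ × ℝ) := by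
  obtain ⟨ρ, hρ, hball⟩ := Metric.isOpen_iff.1 hT q q.2
  have hb : IsOpenEmbedding (OpenPartialHomeomorph.univBall (q : ℝ × ℝ) ρ) :=
    OpenPartialHomeomorph.isOpenEmbedding _ (OpenPartialHomeomorph.univBall_source _ ρ)
  have hbT : ∀ z, OpenPartialHomeomorph.univBall (q : ℝ × ℝ) ρ z ∈ T := fun z => hball <| by
    rw [← OpenPartialHomeomorph.univBall_target _ hρ]
    exact OpenPartialHomeomorph.map_source _ (by simp)
  let b : ℝ × ℝ → T := fun z => ⟨_, hbT z⟩
  have hbe : IsOpenEmbedding b :=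
    IsOpenEmbedding.of_comp b hT.isOpenEmbedding_subtypeVal hb
  have hfb := hf.comp hbe
  refine ⟨range (f ∘ b), hfb.isOpen_range.mem_nhds ⟨0, ?_⟩, ⟨hfb.isEmbedding.toHomeomorph.symm⟩⟩
  exact congrArg f (Subtype.ext (OpenPartialHomeomorph.univBall_apply_zero _ ρ))

/-! ### The topology of the Prüferised octant -/

namespace PruferOctant

variable {Φ : ∀ α : CountableLimit, DiagonalChart α}

theorem isOpen_iff {U : Set (PruferOctant Φ)} : IsOpen U ↔ IsOpen (inner ⁻¹' U) ∧
    ∀ α r, line α r ∈ U → ∃ u v w : ℝ, u < r ∧ r < v ∧ 0 < w ∧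
      (∀ q ∈ Ioo u v, line α q ∈ U) ∧ ∀ p ∈ wedge (Φ α) u v w, inner p ∈ U := Iff.rfl

theorem inner_injective : Function.Injective (inner : OpenOctant → PruferOctant Φ) :=
  fun _ _ h => inner.inj h

theorem isOpenEmbedding_inner : IsOpenEmbedding (inner : OpenOctant → PruferOctant Φ) := by
  refine .of_continuous_injective_isOpenMap ⟨fun U hU => (isOpen_iff.1 hU).1⟩ inner_injective ?_
  intro U hU
  refine isOpen_iff.2 ⟨?_, ?_⟩
  · rwa [preimage_image_eq _ inner_injective]
  · rintro α r ⟨p, -, hp⟩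
    cases hp

theorem continuous_line (α : CountableLimit) : Continuous (line α : ℝ → PruferOctant Φ) := by
  refine ⟨fun U hU => isOpen_iff_mem_nhds.2 fun r hr => ?_⟩
  obtain ⟨u, v, w, hu, hv, -, h, -⟩ := (isOpen_iff.1 hU).2 α r hr
  exact Filter.mem_of_superset (Ioo_mem_nhds hu hv) h

/-- The basic open sets at the points of the attached lines. -/
def lineNhd (Φ : ∀ α : CountableLimit, DiagonalChart α) (α : CountableLimit) (u v w : ℝ) :
    Set (PruferOctant Φ) := line α '' Ioo u v ∪ inner '' wedge (Φ α) u v w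

theorem line_mem_lineNhd {α β : CountableLimit} {u v w r : ℝ} :
    line β r ∈ lineNhd Φ α u v w ↔ β = α ∧ r ∈ Ioo u v := by
  constructor
  · rintro (⟨q, hq, h⟩ | ⟨p, -, h⟩)
    · cases h
      exact ⟨rfl, hq⟩
    · cases h
  · rintro ⟨rfl, h⟩
    exact Or.inl ⟨r, h, rfl⟩

theorem inner_mem_lineNhd {α : CountableLimit} {u v w : ℝ} {p : OpenOctant} :
    inner p ∈ lineNhd Φ α u v w ↔ p ∈ wedge (Φ α) u v w := by
  constructor
  · rintro (⟨q, -, h⟩ | ⟨p, hp, h⟩)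
    · cases h
    · cases h
      exact hp
  · exact fun h => Or.inr ⟨p, h, rfl⟩

theorem isOpen_lineNhd (α : CountableLimit) (u v : ℝ) {w : ℝ} (hw : 0 < w) :
    IsOpen (lineNhd Φ α u v w) := by
  refine isOpen_iff.2 ⟨?_, ?_⟩
  · have : inner ⁻¹' lineNhd Φ α u v w = wedge (Φ α) u v w := by
      ext p
      exact inner_mem_lineNhd
    rw [this]
    exact (Φ α).isOpen_wedge u v w
  · intro β r hr
    obtain ⟨rfl, hr'⟩ := line_mem_lineNhd.1 hr
    exact ⟨u, v, w, hr'.1, hr'.2, hw, fun q hq => line_mem_lineNhd.2 ⟨rfl, hq⟩,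
      fun p hp => inner_mem_lineNhd.2 hp⟩

/-! ### The Hausdorff property -/

theorem exists_disjoint_inner_line (p : OpenOctant) (α : CountableLimit) (r : ℝ) :
    ∃ U V : Set (PruferOctant Φ), IsOpen U ∧ IsOpen V ∧ inner p ∈ U ∧ line α r ∈ V ∧
      Disjoint U V := by
  have hfc := (Φ α).continuous_fst
  have hsc := (Φ α).continuous_snd
  suffices h : ∃ U : Set OpenOctant, IsOpen U ∧ p ∈ U ∧ ∃ w > 0,
      ∀ q ∈ U, q ∉ wedge (Φ α) (r - 1) (r + 1) w by
    obtain ⟨U, hU, hp, w, hw, hd⟩ := h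
    refine ⟨inner '' U, lineNhd Φ α (r - 1) (r + 1) w, isOpenEmbedding_inner.isOpenMap U hU,
      isOpen_lineNhd α _ _ hw, mem_image_of_mem _ hp,
      line_mem_lineNhd.2 ⟨rfl, by linarith, by linarith⟩, ?_⟩
    rw [disjoint_left]
    rintro _ ⟨q, hq, rfl⟩ hq'
    exact hd q hq (inner_mem_lineNhd.1 hq')
  rcases lt_or_ge p.1.1 α.next with h | h
  · have hlt := (Φ α).snd_lt_fst h
    set d := (Φ α).fst p - (Φ α).snd p with hd
    refine ⟨{q | d / 2 < (Φ α).fst q - (Φ α).snd q}, isOpen_lt (by fun_prop) (by fun_prop), ?_,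
      d / 2, by linarith, ?_⟩
    · change d / 2 < d
      linarith
    · intro q hq hq'
      exact lt_asymm hq ((Φ α).mem_wedge_iff.1 hq').2.2.2
  -- Here `x' = 2` at `p`. In a wedge of this width `x' - 1 < (|r| + 1) (x' - y') < 1 / 2`.
  · refine ⟨{q | 3 / 2 < (Φ α).fst q}, isOpen_lt (by fun_prop) (by fun_prop), ?_,
      1 / (2 * (|r| + 1)), by positivity, ?_⟩
    · have : (Φ α).fst p = 2 := (Φ α).ext_of_next_le h
      change 3 / 2 < (Φ α).fst p
      linarith
    · intro q hq hq'
      obtain ⟨-, -, h2, h3⟩ := (Φ α).mem_wedge_iff.1 hq'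
      have hq2 : 3 / 2 < (Φ α).fst q := hq
      have h0 := (Φ α).snd_le_fst q
      rw [lt_div_iff₀ (by positivity)] at h3
      have h4 : (r + 1) * ((Φ α).fst q - (Φ α).snd q) ≤
          (|r| + 1) * ((Φ α).fst q - (Φ α).snd q) :=
        mul_le_mul_of_nonneg_right (by linarith [le_abs_self r]) (by linarith)
      linarith

/-- As `β` is a limit, `α + 1 < β`. Wedges at `α` lie below height `α + 1`, whose `Φ β`-coordinate
is `c < 1`. In the wedge at `β`, `y' > 1 - (|s| + 2) (x' - y')`, which exceeds `c` for the chosen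
width. -/
theorem exists_disjoint_line_line_of_lt {α β : CountableLimit} (h : α.1 < β.1) (r s : ℝ) :
    ∃ U V : Set (PruferOctant Φ), IsOpen U ∧ IsOpen V ∧ line α r ∈ U ∧ line β s ∈ V ∧
      Disjoint U V := by
  have hlt : α.next < β.pt := LongRay.lt_ofOrdinal_iff.2 (β.2.2.succ_lt h)
  have hmem : α.next ∈ Ioo (0 : LongRay) β.next :=
    ⟨α.pt_mem.1.trans α.pt_mem.2, hlt.trans β.pt_mem.2⟩
  have hc : (Φ β).ext α.next < 1 := by
    rw [← (Φ β).ext_pt, (Φ β).ext_lt_ext hmem β.pt_mem]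
    exact hlt
  set c := (Φ β).ext α.next with hcdef
  refine ⟨lineNhd Φ α (r - 1) (r + 1) 1, lineNhd Φ β (s - 1) (s + 1) ((1 - c) / (|s| + 2)),
    isOpen_lineNhd _ _ _ one_pos, isOpen_lineNhd _ _ _ (div_pos (by linarith) (by positivity)),
    line_mem_lineNhd.2 ⟨rfl, by linarith, by linarith⟩,
    line_mem_lineNhd.2 ⟨rfl, by linarith, by linarith⟩, ?_⟩
  rw [disjoint_left]
  rintro (p | ⟨γ, q⟩) h1 h2
  · obtain ⟨h3, -⟩ := (Φ α).mem_wedge_iff.1 (inner_mem_lineNhd.1 h1)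
    obtain ⟨-, h4, -, h5⟩ := (Φ β).mem_wedge_iff.1 (inner_mem_lineNhd.1 h2)
    have h6 : (Φ β).snd p ≤ c := (Φ β).monotone_ext (p.2.2.trans h3).le
    have h0 := (Φ β).snd_le_fst p
    rw [lt_div_iff₀ (by positivity)] at h5
    have h7 : -(|s| + 1) * ((Φ β).fst p - (Φ β).snd p) ≤
        (s - 1) * ((Φ β).fst p - (Φ β).snd p) :=
      mul_le_mul_of_nonneg_right (by linarith [neg_abs_le s]) (by linarith)
    linarith
  · have h3 := (line_mem_lineNhd.1 h1).1
    have h4 := (line_mem_lineNhd.1 h2).1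
    rw [← h3, ← h4] at h
    exact lt_irrefl _ h

theorem exists_disjoint_line_line_of_slope_lt (α : CountableLimit) {r s : ℝ} (h : r < s) :
    ∃ U V : Set (PruferOctant Φ), IsOpen U ∧ IsOpen V ∧ line α r ∈ U ∧ line α s ∈ V ∧
      Disjoint U V := by
  obtain ⟨m, hrm, hms⟩ := exists_between h
  refine ⟨lineNhd Φ α (r - 1) m 1, lineNhd Φ α m (s + 1) 1,
    isOpen_lineNhd _ _ _ one_pos, isOpen_lineNhd _ _ _ one_pos,
    line_mem_lineNhd.2 ⟨rfl, by linarith, hrm⟩,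
    line_mem_lineNhd.2 ⟨rfl, hms, by linarith⟩, ?_⟩
  rw [disjoint_left]
  rintro (p | ⟨γ, q⟩) h1 h2
  · exact lt_asymm ((Φ α).mem_wedge_iff.1 (inner_mem_lineNhd.1 h1)).2.2.1
      ((Φ α).mem_wedge_iff.1 (inner_mem_lineNhd.1 h2)).2.1
  · exact lt_asymm (line_mem_lineNhd.1 h1).2.2 (line_mem_lineNhd.1 h2).2.1

instance : T2Space (PruferOctant Φ) := by
  refine ⟨?_⟩
  have symm : ∀ {x y : PruferOctant Φ}, (∃ U V : Set (PruferOctant Φ), IsOpen U ∧ IsOpen V ∧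
      x ∈ U ∧ y ∈ V ∧ Disjoint U V) → ∃ U V : Set (PruferOctant Φ), IsOpen U ∧ IsOpen V ∧
      y ∈ U ∧ x ∈ V ∧ Disjoint U V :=
    fun ⟨U, V, h1, h2, h3, h4, h5⟩ => ⟨V, U, h2, h1, h4, h3, h5.symm⟩
  rintro (p | ⟨α, r⟩) (q | ⟨β, s⟩) hne
  · obtain ⟨U, V, hU, hV, hp, hq, hd⟩ := t2_separation fun h : p = q => hne (h ▸ rfl)
    refine ⟨inner '' U, inner '' V, isOpenEmbedding_inner.isOpenMap U hU,
      isOpenEmbedding_inner.isOpenMap V hV, mem_image_of_mem _ hp, mem_image_of_mem _ hq, ?_⟩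
    exact (disjoint_image_iff inner_injective).2 hd
  · exact exists_disjoint_inner_line p β s
  · exact symm (exists_disjoint_inner_line q α r)
  · rcases lt_trichotomy α.1 β.1 with h | h | h
    · exact exists_disjoint_line_line_of_lt h r s
    · obtain rfl : α = β := Subtype.ext h
      rcases lt_trichotomy r s with h | h | h
      · exact exists_disjoint_line_line_of_slope_lt α h
      · exact absurd (h ▸ rfl) hne
      · exact symm (exists_disjoint_line_line_of_slope_lt α h)
    · exact symm (exists_disjoint_line_line_of_lt h s r)

/-! ### Half-plane charts at the attached lines -/

/-- The distance from the diagonal that corresponds to the point `(m, t)` of the half plane. -/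
def width (p : ℝ × NNReal) : ℝ := p.2 / ((1 + p.2) * (|p.1| + 2))

theorem continuous_width : Continuous width := by
  refine Continuous.div (by fun_prop) (by fun_prop) fun p => ?_
  positivity

theorem width_le (p : ℝ × NNReal) : width p ≤ p.2 := by
  refine div_le_self p.2.2 ?_
  have h1 : (1 : ℝ) ≤ 1 + p.2 := le_add_of_nonneg_right p.2.2
  have h2 : (1 : ℝ) ≤ |p.1| + 2 := by linarith [abs_nonneg p.1]
  exact one_le_mul_of_one_le_of_one_le h1 h2

/-- The width is chosen for this: at a fixed slope, `t ↦ t / (1 + t)` maps `[0, ∞)` bijectively onto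
`[0, 1)`, and the bound `s (|m| + 2) < 1` keeps `slopePoint m s` in the triangle. -/
theorem width_mul (p : ℝ × NNReal) : width p * (|p.1| + 2) = p.2 / (1 + p.2) := by
  have h1 : (1 : ℝ) + p.2 ≠ 0 := by positivity
  have h2 : |p.1| + 2 ≠ 0 := by positivity
  rw [width]
  field_simp

theorem width_mul_lt_one (p : ℝ × NNReal) : width p * (|p.1| + 2) < 1 := by
  rw [width_mul, div_lt_one (by positivity)]
  linarith

/-- The point of the plane at slope `m` and at distance `s` from the diagonal. -/
def slopePoint (m s : ℝ) : ℝ × ℝ := (1 + m * s, 1 + (m - 1) * s)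

theorem slopePoint_mem {m s : ℝ} (hs : 0 < s) (h : s * (|m| + 2) < 1) :
    slopePoint m s ∈ openTriangle := by
  have h1 : m * s ≤ |m| * s := mul_le_mul_of_nonneg_right (le_abs_self m) hs.le
  have h2 : -|m| * s ≤ m * s := mul_le_mul_of_nonneg_right (neg_abs_le m) hs.le
  refine ⟨?_, ?_, ?_⟩ <;> simp only [slopePoint] <;> linarith

theorem slopePoint_width_mem {p : ℝ × NNReal} (hp : p.2 ≠ 0) :
    slopePoint p.1 (width p) ∈ openTriangle := by
  have h0 : (0 : ℝ) < p.2 := NNReal.coe_pos.2 (pos_iff_ne_zero.2 hp)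
  refine slopePoint_mem ?_ (width_mul_lt_one p)
  unfold width
  positivity

open Classical in
/-- The half-plane chart around the line attached at `⟨α, α⟩`. -/
def lineChart (Φ : ∀ α : CountableLimit, DiagonalChart α) (α : CountableLimit)
    (p : ℝ × NNReal) : PruferOctant Φ :=
  if h : p.2 = 0 then line α p.1 else inner ((Φ α).ofTriangle ⟨_, slopePoint_width_mem h⟩)

theorem lineChart_zero (α : CountableLimit) (r : ℝ) : lineChart Φ α (r, 0) = line α r :=
  dif_pos rfl

theorem lineChart_of_ne {α : CountableLimit} {p : ℝ × NNReal} (h : p.2 ≠ 0) :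
    lineChart Φ α p = inner ((Φ α).ofTriangle ⟨_, slopePoint_width_mem h⟩) := dif_neg h

theorem continuous_lineChart (α : CountableLimit) : Continuous (lineChart Φ α) := by
  rw [continuous_iff_continuousAt]
  rintro ⟨m, t⟩
  by_cases ht : t = 0
  · subst ht
    rw [ContinuousAt, lineChart_zero, (nhds_basis_opens _).tendsto_right_iff]
    rintro U ⟨hm, hU⟩
    obtain ⟨u, v, w, hu, hv, hw, h1, h2⟩ := (isOpen_iff.1 hU).2 α m hm
    have hev : ∀ᶠ p : ℝ × NNReal in 𝓝 (m, 0), (u < p.1 ∧ p.1 < v) ∧ (p.2 : ℝ) < w := by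
      refine ((isOpen_lt continuous_const continuous_fst).inter
        (isOpen_lt continuous_fst continuous_const)).inter
        (isOpen_lt (f := fun p : ℝ × NNReal => (p.2 : ℝ)) (by fun_prop) continuous_const)
        |>.mem_nhds ⟨⟨hu, hv⟩, ?_⟩
      simpa using hw
    filter_upwards [hev] with p hp
    by_cases h : p.2 = 0
    · obtain ⟨m', t'⟩ := p
      obtain rfl : t' = 0 := h
      rw [lineChart_zero]
      exact h1 m' hp.1
    · rw [lineChart_of_ne h]
      refine h2 _ ((Φ α).mem_wedge_iff.2 ⟨(Φ α).ofTriangle_fst_lt _, ?_⟩)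
      rw [(Φ α).fst_ofTriangle, (Φ α).snd_ofTriangle]
      have hpos : 0 < width p := by
        have := (slopePoint_width_mem h).2.1
        simp only [slopePoint] at this
        linarith
      have e : (slopePoint p.1 (width p)).1 - (slopePoint p.1 (width p)).2 = width p := by
        simp only [slopePoint]
        ring
      rw [e]
      simp only [slopePoint, add_sub_cancel_left]
      exact ⟨mul_lt_mul_of_pos_right hp.1.1 hpos, mul_lt_mul_of_pos_right hp.1.2 hpos,
        (width_le p).trans_lt hp.2⟩
  · have hopen : IsOpen {p : ℝ × NNReal | p.2 ≠ 0} :=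
      (isClosed_singleton.preimage continuous_snd).isOpen_compl
    refine ContinuousOn.continuousAt ?_ (hopen.mem_nhds ht)
    rw [continuousOn_iff_continuous_domRestrict]
    have : {p : ℝ × NNReal | p.2 ≠ 0}.domRestrict (lineChart Φ α) =
        fun p => inner ((Φ α).ofTriangle ⟨_, slopePoint_width_mem p.2⟩) :=
      funext fun p => lineChart_of_ne p.2
    rw [this]
    refine isOpenEmbedding_inner.continuous.comp ((Φ α).isOpenEmbedding_ofTriangle.continuous.comp
      (Continuous.subtype_mk ?_ _))
    have := continuous_width
    unfold slopePoint
    fun_prop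

theorem lineChart_injective (α : CountableLimit) : Function.Injective (lineChart Φ α) := by
  intro p q h
  by_cases hp : p.2 = 0 <;> by_cases hq : q.2 = 0
  · rw [lineChart, dif_pos hp, lineChart, dif_pos hq] at h
    exact Prod.ext (line.inj h).2 (hp.trans hq.symm)
  · rw [lineChart, dif_pos hp, lineChart_of_ne hq] at h
    cases h
  · rw [lineChart_of_ne hp, lineChart, dif_pos hq] at h
    cases h
  · rw [lineChart_of_ne hp, lineChart_of_ne hq] at h
    have h1 := congrArg Subtype.val ((Φ α).isOpenEmbedding_ofTriangle.injective (inner.inj h))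
    simp only [slopePoint, Prod.mk.injEq] at h1
    have h2 : width p = width q := by linarith [h1.1, h1.2]
    have hpos : 0 < width p := by
      have := (slopePoint_width_mem hp).2.1
      simp only [slopePoint] at this
      linarith
    have h3 : p.1 = q.1 := by
      have := h1.1
      rw [← h2] at this
      exact mul_right_cancel₀ hpos.ne' (add_left_cancel this)
    have h4 := width_mul p
    rw [h2, h3, width_mul q, div_eq_div_iff (by positivity) (by positivity)] at h4
    exact Prod.ext h3 (NNReal.coe_injective (by linarith))

/-- The point of the half plane at slope `m` and at distance `s` from the diagonal. -/
def ofSlope (q : ℝ × ℝ) : ℝ × NNReal :=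
  (q.1, Real.toNNReal (q.2 * (|q.1| + 2) / (1 - q.2 * (|q.1| + 2))))

theorem continuousAt_ofSlope {q : ℝ × ℝ} (h : q.2 * (|q.1| + 2) < 1) :
    ContinuousAt ofSlope q := by
  refine continuousAt_fst.prodMk (continuous_real_toNNReal.continuousAt.comp ?_)
  refine ContinuousAt.div (by fun_prop) (by fun_prop) ?_
  exact (sub_pos.2 h).ne'

/-- With `k = s (|m| + 2)`, the function `k / (1 - k)` inverts `t / (1 + t)`. -/
theorem width_ofSlope {q : ℝ × ℝ} (h0 : 0 < q.2) (h : q.2 * (|q.1| + 2) < 1) :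
    (ofSlope q).2 ≠ 0 ∧ width (ofSlope q) = q.2 := by
  have h1 : 0 < 1 - q.2 * (|q.1| + 2) := sub_pos.2 h
  have h2 : 0 < q.2 * (|q.1| + 2) / (1 - q.2 * (|q.1| + 2)) := by positivity
  refine ⟨(Real.toNNReal_pos.2 h2).ne', ?_⟩
  have h3 := width_mul (ofSlope q)
  have h4 : |q.1| + 2 ≠ 0 := by positivity
  have e : ((ofSlope q).2 : ℝ) = q.2 * (|q.1| + 2) / (1 - q.2 * (|q.1| + 2)) :=
    Real.coe_toNNReal _ h2.le
  have e1 : (ofSlope q).1 = q.1 := rfl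
  rw [e, e1] at h3
  have h5 : q.2 * (|q.1| + 2) / (1 - q.2 * (|q.1| + 2)) /
      (1 + q.2 * (|q.1| + 2) / (1 - q.2 * (|q.1| + 2))) = q.2 * (|q.1| + 2) := by
    generalize q.2 * (|q.1| + 2) = k at h1
    field_simp
    ring
  rw [h5] at h3
  exact mul_right_cancel₀ h4 h3

/-- The slope and the distance from the diagonal on the octant. -/
def slope (Φ : ∀ α : CountableLimit, DiagonalChart α) (α : CountableLimit) (p : OpenOctant) :
    ℝ × ℝ :=
  (((Φ α).fst p - 1) / ((Φ α).fst p - (Φ α).snd p), (Φ α).fst p - (Φ α).snd p)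

theorem slopePoint_slope {α : CountableLimit} {p : OpenOctant} (h : p.1.1 < α.next) :
    slopePoint (slope Φ α p).1 (slope Φ α p).2 = ((Φ α).fst p, (Φ α).snd p) := by
  have := (Φ α).snd_lt_fst h
  have h1 : (Φ α).fst p - (Φ α).snd p ≠ 0 := (sub_pos.2 this).ne'
  simp only [slopePoint, slope]
  refine Prod.ext ?_ ?_
  · simp only
    rw [div_mul_cancel₀ _ h1]
    ring
  · simp only
    rw [sub_mul, div_mul_cancel₀ _ h1]
    ring

/-- The part of the octant covered by a half-plane chart. -/
def chartDomain (Φ : ∀ α : CountableLimit, DiagonalChart α) (α : CountableLimit) :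
    Set OpenOctant :=
  {p | p.1.1 < α.next ∧ (slope Φ α p).2 * (|(slope Φ α p).1| + 2) < 1}

theorem continuousOn_slope (α : CountableLimit) :
    ContinuousOn (slope Φ α) {p | p.1.1 < α.next} := by
  have h1 := (Φ α).continuous_fst
  have h2 := (Φ α).continuous_snd
  refine ContinuousOn.prodMk (ContinuousOn.div (by fun_prop) (by fun_prop) fun p hp => ?_)
    (by fun_prop)
  exact (sub_pos.2 ((Φ α).snd_lt_fst hp)).ne'

theorem isOpen_chartDomain (α : CountableLimit) : IsOpen (chartDomain Φ α) := by
  have : IsOpen {q : ℝ × ℝ | q.2 * (|q.1| + 2) < 1} := isOpen_lt (by fun_prop) (by fun_prop)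
  exact (continuousOn_slope α).isOpen_inter_preimage DiagonalChart.isOpen_lt_next this

theorem lineChart_ofSlope {α : CountableLimit} {p : OpenOctant} (hp : p ∈ chartDomain Φ α) :
    lineChart Φ α (ofSlope (slope Φ α p)) = inner p := by
  obtain ⟨h1, h2⟩ := width_ofSlope (sub_pos.2 ((Φ α).snd_lt_fst hp.1)) hp.2
  rw [lineChart_of_ne h1]
  congr 1
  refine Eq.trans (congrArg _ (Subtype.ext ?_)) ((Φ α).ofTriangle_coords hp.1)
  simp only [h2]
  exact slopePoint_slope hp.1

theorem lineChart_eq_inner {α : CountableLimit} {q : ℝ × NNReal} {p : OpenOctant}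
    (h : lineChart Φ α q = inner p) : p ∈ chartDomain Φ α := by
  by_cases hq : q.2 = 0
  · rw [lineChart, dif_pos hq] at h
    cases h
  · rw [lineChart_of_ne hq] at h
    obtain rfl := inner.inj h
    refine ⟨(Φ α).ofTriangle_fst_lt _, ?_⟩
    have hpos : 0 < width q := by
      have := (slopePoint_width_mem hq).2.1
      simp only [slopePoint] at this
      linarith
    have e : slope Φ α ((Φ α).ofTriangle ⟨_, slopePoint_width_mem hq⟩) = (q.1, width q) := by
      have e1 : (slopePoint q.1 (width q)).1 - (slopePoint q.1 (width q)).2 = width q := by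
        simp only [slopePoint]
        ring
      rw [slope, (Φ α).fst_ofTriangle, (Φ α).snd_ofTriangle, e1]
      simp only [slopePoint, add_sub_cancel_left]
      rw [mul_div_cancel_right₀ _ hpos.ne']
    rw [e]
    exact width_mul_lt_one q

/-- Over the octant the inverse is `ofSlope ∘ slope`, continuous on `chartDomain`. At the edge, a
ball for the maximum metric around `(r, 0)` in slope and width contains a whole wedge, so images of
open sets are neighbourhoods there too. -/
theorem isOpenEmbedding_lineChart (α : CountableLimit) : IsOpenEmbedding (lineChart Φ α) := by
  refine .of_continuous_injective_isOpenMap (continuous_lineChart α) (lineChart_injective α) ?_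
  intro V hV
  refine isOpen_iff.2 ⟨?_, ?_⟩
  · have : inner ⁻¹' (lineChart Φ α '' V) =
        chartDomain Φ α ∩ (fun p => ofSlope (slope Φ α p)) ⁻¹' V := by
      ext p
      constructor
      · rintro ⟨q, hq, h⟩
        have hp := lineChart_eq_inner h
        refine ⟨hp, ?_⟩
        rw [mem_preimage, lineChart_injective α ((lineChart_ofSlope hp).trans h.symm)]
        exact hq
      · rintro ⟨hp, hq⟩
        exact ⟨_, hq, lineChart_ofSlope hp⟩
    rw [this]
    refine ContinuousOn.isOpen_inter_preimage ?_ (isOpen_chartDomain α) hV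
    intro p hp
    exact (continuousAt_ofSlope hp.2).comp_continuousWithinAt
      ((continuousOn_slope α p hp.1).mono fun q hq => hq.1)
  · rintro β r ⟨q, hq, h⟩
    have hq0 : q = (r, 0) ∧ β = α := by
      by_cases hq2 : q.2 = 0
      · rw [lineChart, dif_pos hq2] at h
        cases h
        exact ⟨Prod.ext rfl hq2, rfl⟩
      · rw [lineChart_of_ne hq2] at h
        cases h
    obtain ⟨rfl, rfl⟩ := hq0
    have h0 : ofSlope (r, 0) = (r, 0) := by simp [ofSlope]
    have hev1 : ∀ᶠ q in 𝓝 ((r, 0) : ℝ × ℝ), ofSlope q ∈ V :=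
      (continuousAt_ofSlope (by simp)).eventually_mem (by rw [h0]; exact hV.mem_nhds hq)
    have hev2 : ∀ᶠ q in 𝓝 ((r, 0) : ℝ × ℝ), q.2 * (|q.1| + 2) < 1 :=
      (isOpen_lt (by fun_prop) (by fun_prop)).mem_nhds (by simp)
    obtain ⟨ε, hε, hball⟩ := Metric.mem_nhds_iff.1 (hev1.and hev2)
    refine ⟨r - ε, r + ε, ε, by linarith, by linarith, hε, ?_, ?_⟩
    · intro q hq
      have hm : ((q, 0) : ℝ × ℝ) ∈ Metric.ball ((r, 0) : ℝ × ℝ) ε := by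
        rw [Metric.mem_ball, Prod.dist_eq, max_lt_iff]
        exact ⟨by rw [Real.dist_eq, abs_lt]; constructor <;> linarith [hq.1, hq.2], by simpa⟩
      have h2 := (hball hm).1
      have : ofSlope (q, 0) = (q, 0) := by simp [ofSlope]
      rw [this] at h2
      exact ⟨_, h2, lineChart_zero _ _⟩
    · intro p hp
      obtain ⟨h1, h2, h3, h4⟩ := (Φ β).mem_wedge_iff.1 hp
      have hd : 0 < (Φ β).fst p - (Φ β).snd p := sub_pos.2 ((Φ β).snd_lt_fst h1)
      have hm : slope Φ β p ∈ Metric.ball ((r, 0) : ℝ × ℝ) ε := by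
        rw [Metric.mem_ball, Prod.dist_eq, max_lt_iff]
        rw [← lt_div_iff₀ hd] at h2
        rw [← div_lt_iff₀ hd] at h3
        constructor
        · rw [Real.dist_eq, abs_lt]
          simp only [slope]
          constructor <;> linarith
        · rw [Real.dist_eq, abs_lt]
          simp only [slope]
          constructor <;> linarith
      obtain ⟨h5, h6⟩ := hball hm
      exact ⟨_, h5, lineChart_ofSlope ⟨h1, h6⟩⟩

end PruferOctant

/-! ### Bounds in the long ray -/

theorem LongRay.exists_ordinal_gt {ι : Type*} [Countable ι] (f : ι → LongRay) :
    ∃ (β : Ordinal.{0}) (hβ : β < Ordinal.omega 1), ∀ i, f i < LongRay.ofOrdinal β hβ := by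
  have hsmall : Small.{0} ι := Countable.toSmall ι
  have hlt : ⨆ i, (f i).ord < Ordinal.omega 1 :=
    Ordinal.iSup_lt_omega_one fun i => (f i).ord_lt
  refine ⟨succ (⨆ i, (f i).ord), (Cardinal.isSuccLimit_omega 1).succ_lt hlt, fun i => ?_⟩
  exact LongRay.lt_ofOrdinal_iff.2 (lt_succ_iff.2 (Ordinal.le_iSup (fun i => (f i).ord) i))

theorem OpenOctant.exists_fst_lt_next (p : OpenOctant) : ∃ α : CountableLimit, p.1.1 < α.next := by
  have h1 : p.1.1.ord + Ordinal.omega0 < Ordinal.omega 1 := by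
    have : Ordinal.IsPrincipal (· + ·) (Ordinal.omega.{0} 1) := Ordinal.isPrincipal_add_omega 1
    exact this p.1.1.ord_lt Ordinal.omega0_lt_omega_one
  -- Adding `ω` gives a limit ordinal, still countable because `ω₁` is additively principal.
  refine ⟨⟨p.1.1.ord + Ordinal.omega0, h1,
    Ordinal.isSuccLimit_add _ Ordinal.isSuccLimit_omega0⟩, ?_⟩
  refine LongRay.lt_ofOrdinal_iff.2 (lt_succ_iff.2 ?_)
  exact le_self_add

/-! ### Surface structure, boundary and zero points -/

namespace PruferOctant

variable {Φ : ∀ α : CountableLimit, DiagonalChart α}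

theorem exists_nhds_inner_homeomorph_plane (p : OpenOctant) :
    ∃ U ∈ 𝓝 (inner p : PruferOctant Φ), Nonempty (U ≃ₜ ℝ × ℝ) := by
  obtain ⟨α, hα⟩ := p.exists_fst_lt_next
  have := (isOpenEmbedding_inner (Φ := Φ)).comp (Φ α).isOpenEmbedding_ofTriangle
  have h := this.exists_nhds_homeomorph_plane isOpen_openTriangle ⟨_, (Φ α).mem_openTriangle hα⟩
  simp only [Function.comp, (Φ α).ofTriangle_coords hα] at h
  exact h

theorem isSurface : IsSurface (PruferOctant Φ) := by
  refine ⟨inferInstance, ?_⟩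
  rintro (p | ⟨α, r⟩)
  · exact exists_nhds_homeomorph_halfPlane_of_plane (exists_nhds_inner_homeomorph_plane p)
  · have h := isOpenEmbedding_lineChart (Φ := Φ) α
    exact ⟨range (lineChart Φ α), h.isOpen_range.mem_nhds ⟨(r, 0), lineChart_zero α r⟩,
      ⟨h.isEmbedding.toHomeomorph.symm⟩⟩

theorem surfaceBoundary_eq : surfaceBoundary (PruferOctant Φ) = lines Φ := by
  ext x
  constructor
  · rcases x with p | ⟨α, r⟩
    · exact fun h => absurd (exists_nhds_inner_homeomorph_plane p) h
    · exact fun _ => ⟨α, r, rfl⟩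
  · rintro ⟨α, r, rfl⟩
    have := not_exists_nhds_homeomorph_plane (isOpenEmbedding_lineChart (Φ := Φ) α) r
    rwa [lineChart_zero] at this

/-- Each attached line is open in their union, so the union is a product of a discrete space and
`ℝ`. -/
theorem metrizableSpace_lines : TopologicalSpace.MetrizableSpace (lines Φ) := by
  let : TopologicalSpace CountableLimit := ⊥
  have : DiscreteTopology CountableLimit := ⟨rfl⟩
  let e : CountableLimit × ℝ → PruferOctant Φ := fun x => line x.1 x.2
  have hc : Continuous e := continuous_prod_of_discrete_left.2 continuous_line
  have he : IsEmbedding e := by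
    refine ⟨⟨le_antisymm hc.le_induced fun V hV => ?_⟩, ?_⟩
    · refine ⟨{x | ∀ α r, x = line α r → (α, r) ∈ V}, isOpen_iff.2 ⟨?_, ?_⟩, ?_⟩
      · convert isOpen_univ
        refine eq_univ_of_forall fun p α r h => ?_
        cases h
      · intro α r hr
        have hV' : IsOpen ((fun r : ℝ => (α, r)) ⁻¹' V) := IsOpen.preimage (by fun_prop) hV
        obtain ⟨u, v, huv, hs⟩ := mem_nhds_iff_exists_Ioo_subset.1
          (hV'.mem_nhds (show r ∈ (fun r : ℝ => (α, r)) ⁻¹' V from hr α r rfl))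
        refine ⟨u, v, 1, huv.1, huv.2, one_pos, ?_, ?_⟩
        · rintro q hq _ _ h
          cases h
          exact hs hq
        · rintro p - _ _ h
          cases h
      · ext ⟨α, r⟩
        refine ⟨fun h => h α r rfl, fun h β s hs => ?_⟩
        cases hs
        exact h
    · rintro ⟨α, r⟩ ⟨β, s⟩ h
      obtain ⟨rfl, rfl⟩ := line.inj h
      rfl
  have hr : lines Φ = range e := by
    ext x
    exact ⟨fun ⟨α, r, h⟩ => ⟨(α, r), h.symm⟩, fun ⟨y, h⟩ => ⟨y.1, y.2, h.symm⟩⟩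
  rw [hr]
  exact he.toHomeomorph.symm.isEmbedding.metrizableSpace

theorem isClosed_zeros : IsClosed (zeros Φ) := by
  refine ⟨isOpen_iff.2 ⟨?_, ?_⟩⟩
  · convert isOpen_univ
    refine eq_univ_of_forall ?_
    rintro p ⟨α, h⟩
    cases h
  · intro α r hr
    have hr0 : r ∈ ({0}ᶜ : Set ℝ) := fun h => hr ⟨α, by rw [mem_singleton_iff.1 h]⟩
    obtain ⟨u, v, huv, hs⟩ := mem_nhds_iff_exists_Ioo_subset.1 (isOpen_compl_singleton.mem_nhds hr0)
    refine ⟨u, v, 1, huv.1, huv.2, one_pos, ?_, ?_⟩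
    · rintro q hq ⟨β, h⟩
      cases h
      exact hs hq rfl
    · rintro p - ⟨β, h⟩
      cases h

theorem discreteTopology_zeros : DiscreteTopology (zeros Φ) := by
  refine discreteTopology_subtype_iff'.2 ?_
  rintro _ ⟨α, rfl⟩
  refine ⟨lineNhd Φ α (-1) 1 1, isOpen_lineNhd _ _ _ one_pos, ?_⟩
  ext x
  constructor
  · rintro ⟨h, β, rfl⟩
    rw [(line_mem_lineNhd.1 h).1]
    rfl
  · rintro rfl
    exact ⟨line_mem_lineNhd.2 ⟨rfl, by norm_num, by norm_num⟩, α, rfl⟩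

/-! ### The zero points do not form a Gδ set -/

/-- A neighbourhood of `0` in an attached line contains a piece of the vertical line below it. -/
theorem exists_vertical_subset {U : Set (PruferOctant Φ)} (hU : IsOpen U) {α : CountableLimit}
    (hα : line α 0 ∈ U) :
    ∃ c < α.pt, ∀ p : OpenOctant, p.1.1 = α.pt → c < p.1.2 → inner p ∈ U := by
  obtain ⟨u, v, w, hu, hv, hw, -, h⟩ := (isOpen_iff.1 hU).2 α 0 hα
  have hmem : {z | 1 - w < (Φ α).ext z} ∈ 𝓝 α.pt := by
    refine (isOpen_lt continuous_const (Φ α).continuous_ext).mem_nhds ?_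
    change 1 - w < (Φ α).ext α.pt
    rw [(Φ α).ext_pt]
    linarith
  obtain ⟨c, hc, hsub⟩ := exists_Ioc_subset_of_mem_nhds hmem ⟨0, α.pt_mem.1⟩
  refine ⟨c, hc, fun p hp hcp => h p ((Φ α).mem_wedge_iff.2 ?_)⟩
  have hlt : p.1.1 < α.next := hp ▸ α.pt_mem.2
  have h1 : (Φ α).fst p = 1 := by rw [DiagonalChart.fst, hp, (Φ α).ext_pt]
  have h2 := (Φ α).snd_lt_fst hlt
  have h3 : 1 - w < (Φ α).snd p := hsub ⟨hcp, hp ▸ p.2.2.le⟩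
  -- On the vertical line `x' - 1 = 0`, so the slope conditions reduce to `u < 0 < v`.
  rw [h1] at h2 ⊢
  have h4 : 0 < 1 - (Φ α).snd p := sub_pos.2 h2
  refine ⟨hlt, ?_, ?_, by linarith⟩
  · rw [sub_self]
    exact mul_neg_of_neg_of_pos hu h4
  · rw [sub_self]
    exact mul_pos hv h4

/-- An open set that contains all zero points contains a tail of every sufficiently high
horizontal line. -/
theorem exists_forall_tail_subset {U : Set (PruferOctant Φ)} (hU : IsOpen U) (hz : zeros Φ ⊆ U) :
    ∃ β : LongRay, ∀ y > β, ∃ b : LongRay, ∀ p : OpenOctant, p.1.2 = y → b ≤ p.1.1 →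
      inner p ∈ U := by
  by_contra! hcon
  let pt : Iio (Ordinal.omega.{0} 1) → LongRay := fun a => LongRay.ofOrdinal a.1 a.2
  choose y hy P hPy hPb hPU using hcon
  -- Closing off: `a'` lies above all heights and all bad points indexed by ordinals up to `a`.
  -- Treating every `η ≤ a` at once makes the step depend on `a` alone.
  have hstep : ∀ a : Iio (Ordinal.omega.{0} 1), ∃ a' : Iio (Ordinal.omega.{0} 1), a < a' ∧
      ∀ η ≤ a, y (pt η) < pt a' ∧ (P (pt η) (pt a)).1.1 < pt a' := by
    intro a
    have hcount : Countable (Iio (succ a.1)) :=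
      (countable_Iio_of_lt_omega_one ((Cardinal.isSuccLimit_omega 1).succ_lt a.2)).to_subtype
    let toΩ : Iio (succ a.1) → Iio (Ordinal.omega.{0} 1) := fun η =>
      ⟨η.1, lt_of_le_of_lt (lt_succ_iff.1 (mem_Iio.1 η.2)) (mem_Iio.1 a.2)⟩
    obtain ⟨β₁, hβ₁, h1⟩ := LongRay.exists_ordinal_gt fun η => y (pt (toΩ η))
    obtain ⟨β₂, hβ₂, h2⟩ := LongRay.exists_ordinal_gt fun η => (P (pt (toΩ η)) (pt a)).1.1
    obtain ⟨β₃, hβ₃, h3⟩ := LongRay.exists_ordinal_gt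
      fun i : Bool => bif i then LongRay.ofOrdinal β₁ hβ₁ else LongRay.ofOrdinal β₂ hβ₂
    have hmem : ∀ η ≤ a, η.1 ∈ Iio (succ a.1) := fun η hη => mem_Iio.2 (lt_succ_iff.2 (Subtype.coe_le_coe.2 hη))
    have h4 : ∀ η ≤ a, y (pt η) < LongRay.ofOrdinal β₃ hβ₃ := fun η hη =>
      (h1 ⟨η.1, hmem η hη⟩).trans (h3 true)
    refine ⟨⟨β₃, hβ₃⟩, ?_, fun η hη => ⟨h4 η hη, (h2 ⟨η.1, hmem η hη⟩).trans (h3 false)⟩⟩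
    have h5 := (hy (pt a)).trans (h4 a le_rfl)
    exact LongRay.lt_ofOrdinal_iff.1 h5
  choose step hlt hstep using hstep
  let a : ℕ → Iio (Ordinal.omega.{0} 1) := fun n => step^[n] ⟨0, Ordinal.omega_pos 1⟩
  have ha : ∀ n, a (n + 1) = step (a n) := fun n => Function.iterate_succ_apply' _ _ _
  have hmono : StrictMono a := strictMono_nat_of_lt_succ fun n => by
    rw [ha]
    exact hlt _
  set γ : Ordinal.{0} := ⨆ n, (a n).1 with hγ
  have haγ : ∀ n, (a n).1 < γ := fun n =>
    lt_of_lt_of_le (hmono (Nat.lt_succ_self n)) (Ordinal.le_iSup (fun n => (a n).1) (n + 1))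
  have hγa : ∀ {b}, b < γ → ∃ n, b < (a n).1 := fun {b} hb => (Ordinal.lt_iSup_iff).1 hb
  let α : CountableLimit := ⟨γ, Ordinal.iSup_lt_omega_one fun n => (a n).2, by
    refine ⟨?_, ?_⟩
    · intro h
      exact h.not_lt (haγ 0)
    · refine isSuccPrelimit_of_succ_lt fun b hb => ?_
      obtain ⟨n, hn⟩ := hγa hb
      exact (succ_le_of_lt hn).trans_lt (haγ n)⟩
  have hapt : ∀ n, pt (a n) < α.pt := fun n => LongRay.lt_ofOrdinal_iff.2 (haγ n)
  have hpta : ∀ {z : LongRay}, z < α.pt → ∃ n, z < pt (a n) := fun {z} hz => by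
    obtain ⟨n, hn⟩ := hγa (LongRay.lt_ofOrdinal_iff.1 hz)
    exact ⟨n, LongRay.lt_ofOrdinal_iff.2 hn⟩
  have hptmono : Monotone fun n => pt (a n) := fun m n h =>
    LongRay.ofOrdinal_le_iff.2 (hmono.monotone h)
  obtain ⟨c, hc, hcU⟩ := exists_vertical_subset hU (hz ⟨α, rfl⟩)
  obtain ⟨k, hk⟩ := hpta hc
  have hyα : y (pt (a k)) < α.pt :=
    ((hstep (a k) (a k) le_rfl).1.trans_eq (congrArg pt (ha k).symm)).trans (hapt _)
  let q : OpenOctant := ⟨(α.pt, y (pt (a k))), (LongRay.zero_le _).trans_lt (hy _), hyα⟩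
  have hq : inner q ∈ U := hcU q rfl (hk.trans (hy _))
  -- The bad points at height `y (pt (a k))` have abscissas between `a n` and `a (n + 1)`, hence
  -- converge to `q`.
  have htend : Filter.Tendsto (fun n => P (pt (a k)) (pt (a n))) Filter.atTop (𝓝 q) := by
    refine OpenOctant.isEmbedding_val.tendsto_nhds_iff.2 (Filter.Tendsto.prodMk_nhds ?_ ?_)
    · rw [tendsto_order]
      refine ⟨fun z hz => ?_, fun z hz => ?_⟩
      · obtain ⟨m, hm⟩ := hpta hz
        filter_upwards [Filter.eventually_ge_atTop m] with n hn
        exact hm.trans_le ((hptmono hn).trans (hPb _ _))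
      · filter_upwards [Filter.eventually_ge_atTop k] with n hn
        have h1 := (hstep (a n) (a k) (hmono.monotone hn)).2
        rw [← ha] at h1
        exact h1.trans ((hapt _).trans hz)
    · have : ∀ n, (P (pt (a k)) (pt (a n))).1.2 = q.1.2 := fun n => hPy _ _
      exact tendsto_const_nhds.congr fun n => (this n).symm
  have hev := htend.eventually ((isOpen_iff.1 hU).1.mem_nhds hq)
  obtain ⟨n, hn⟩ := hev.exists
  exact hPU _ _ hn

theorem not_isGδ_zeros : ¬ IsGδ (zeros Φ) := by
  intro h
  obtain ⟨f, hf, hfz⟩ := isGδ_iff_eq_iInter_nat.1 h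
  have hsub : ∀ n, zeros Φ ⊆ f n := fun n => hfz ▸ iInter_subset f n
  choose β hβ using fun n => exists_forall_tail_subset (hf n) (hsub n)
  obtain ⟨η, hη, hηβ⟩ := LongRay.exists_ordinal_gt β
  choose b hb using fun n => hβ n _ (hηβ n)
  -- The index `none` places `ξ` above `η`, so that `⟨ξ, η⟩` lies in the octant.
  obtain ⟨ξ, hξ, hξb⟩ := LongRay.exists_ordinal_gt
    fun i : Option ℕ => i.elim (LongRay.ofOrdinal η hη) b
  let p : OpenOctant := ⟨(LongRay.ofOrdinal ξ hξ, LongRay.ofOrdinal η hη),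
    (LongRay.zero_le _).trans_lt (hηβ 0), hξb none⟩
  have hp : inner p ∈ zeros Φ := by
    rw [hfz]
    exact mem_iInter.2 fun n => hb n p rfl (hξb (some n)).le
  obtain ⟨α, hα⟩ := hp
  cases hα

end PruferOctant

/-! ### Zero-sets, collars and Gδ sets -/

theorem IsZeroSet.isGδ {X : Type*} [TopologicalSpace X] {A : Set X} (h : IsZeroSet A) :
    IsGδ A := by
  obtain ⟨f, hf, rfl⟩ := h
  exact (IsGδ.singleton 0).preimage hf

/-- In a space with a collared metrisable subspace `B`, the closed subsets of `B` are Gδ sets. -/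
theorem IsCollared.isGδ {X : Type*} [TopologicalSpace X] {A B : Set X} (h : IsCollared B)
    [TopologicalSpace.MetrizableSpace B] (hAB : A ⊆ B) (hA : IsClosed A) : IsGδ A := by
  obtain ⟨h, he, h0, -, hopen⟩ := h
  let := TopologicalSpace.metrizableSpaceMetric (B × unitInterval)
  have hcl : IsClosed ((fun p : B × unitInterval => (p.1 : X)) ⁻¹' A ∩ {p | p.2 = 0}) :=
    (hA.preimage (by fun_prop)).inter (isClosed_eq continuous_snd continuous_const)
  obtain ⟨G, hG, hGz⟩ := isGδ_iff_eq_iInter_nat.1 hcl.isGδ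
  refine isGδ_iff_eq_iInter_nat.2 ⟨fun n => h '' (G n ∩ {p | p.2 < 1}), fun n => ?_, ?_⟩
  -- Since `h` is an embedding, `G n = h ⁻¹' W` with `W` open, and the image is `W` intersected with
  -- the open collar.
  · obtain ⟨W, hW, hWG⟩ := he.isInducing.isOpen_iff.1 (hG n)
    simp only [← hWG, image_preimage_inter]
    exact hW.inter hopen
  · ext x
    rw [mem_iInter]
    constructor
    · intro hx n
      refine ⟨(⟨x, hAB hx⟩, 0), ⟨?_, zero_lt_one (α := unitInterval)⟩, h0 _⟩
      exact mem_iInter.1 (hGz ▸ ⟨hx, rfl⟩ :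
        ((⟨x, hAB hx⟩, 0) : B × unitInterval) ∈ ⋂ n, G n) n
    · intro hx
      obtain ⟨p, -, rfl⟩ := hx 0
      have hp : p ∈ ⋂ n, G n := mem_iInter.2 fun n => by
        obtain ⟨q, hq, hqp⟩ := hx n
        rw [← he.injective hqp]
        exact hq.1
      rw [← hGz] at hp
      obtain ⟨hp1, hp2⟩ := hp
      obtain ⟨z, t⟩ := p
      obtain rfl : t = 0 := hp2
      rw [h0]
      exact hp1

end

theorem mainTheorem11 :
    Nonempty (∀ α : CountableLimit, DiagonalChart α) ∧
    ∀ Φ : ∀ α : CountableLimit, DiagonalChart α,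
      IsSurface (PruferOctant Φ) ∧
      surfaceBoundary (PruferOctant Φ) = PruferOctant.lines Φ ∧
      TopologicalSpace.MetrizableSpace (surfaceBoundary (PruferOctant Φ)) ∧
      ¬ IsCollared (surfaceBoundary (PruferOctant Φ)) ∧
      PruferOctant.zeros Φ ⊆ surfaceBoundary (PruferOctant Φ) ∧
      IsClosed (PruferOctant.zeros Φ) ∧
      DiscreteTopology (PruferOctant.zeros Φ) ∧
      ¬ IsGδ (PruferOctant.zeros Φ) ∧
      ¬ IsZeroSet (PruferOctant.zeros Φ) := by
  refine ⟨⟨fun α => (nonempty_diagonalChart α).some⟩, fun Φ => ?_⟩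
  have hzeros : PruferOctant.zeros Φ ⊆ PruferOctant.lines Φ := fun _ ⟨α, h⟩ => ⟨α, 0, h⟩
  have hmetr := PruferOctant.metrizableSpace_lines (Φ := Φ)
  rw [PruferOctant.surfaceBoundary_eq]
  exact ⟨PruferOctant.isSurface, rfl, hmetr,
    fun h => PruferOctant.not_isGδ_zeros (h.isGδ hzeros PruferOctant.isClosed_zeros), hzeros,
    PruferOctant.isClosed_zeros, PruferOctant.discreteTopology_zeros,
    PruferOctant.not_isGδ_zeros, fun h => PruferOctant.not_isGδ_zeros h.isGδ⟩
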